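/- Let $G$ be a finite group, $k$ a field, and $\beta\in Z^3(G,k^*)$ a normalized 3-cocycle ($\beta(g,h,l)=1$ as soon as one argument is $1$). Put $$\theta_g(x,y)=\frac{\beta(g,x,y)\,\beta(x,y,(xy)^{-1}gxy)}{\beta(x,x^{-1}gx,y)},\qquad \gamma_x(g,h)=\frac{\beta(g,h,x)\,\beta(x,x^{-1}gx,x^{-1}hx)}{\beta(g,x,x^{-1}hx)} .$$ The twisted Drinfel'd double $D^\beta(k[G])$ has basis $g\lfloor x$ ($g,x\in G$), product $(g\lfloor x)(h\lfloor y)=\delta_{g,xhx^{-1}}\theta_g(x,y)\,g\lfloor xy$, unit $\sum_g g\lfloor 1$, coproduct $\Delta(g\lfloor x)=\sum_{g_1g_2=g}\gamma_x(g_1,g_2)\,g_1\lfloor x\otimes g_2\lfloor x$, counit $\varepsilon(g\lfloor x)=\delta_{g,1}$, associator $\Phi=\sum\beta(g,h,l)^{-1}\,g\lfloor 1\otimes h\lfloor 1\otimes l\lfloor 1$ and $R=\sum_{g,h} g\lfloor 1\otimes h\lfloor g$. Its finite-dimensional modules form a braided monoidal category $\mathrm{Rep}(D^\beta(k[G]))$: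 the algebra acts on $U\otimes V$ through $\Delta$ and on the unit object $k$ through $\varepsilon$, the associativity constraint is $(u\otimes v)\otimes w\mapsto\Phi\,(u\otimes(v\otimes w))$, and the braiding is $R$ followed by the flip. A $\beta$-twisted bundle on the inertia stack of $[pt/G]$, $\coprod_{[g]}[pt/Z(g)]$, is a family $F$ of finite-dimensional $\theta_g$-twisted representations of the centralizers $Z(g)$, one for each conjugacy class $[g]$. The product of two such bundles is the push-pull product: on the sector of $h$, $$(F\cdot F')_h=\bigoplus_{[m_1,m_2],\ m_1m_2=h}\mathrm{Ind}_{Z(m_1,m_2)}^{Z(h)}\bigl(F_{m_1}|_{Z(m_1,m_2)}\otimes^\gamma F'_{m_2}|_{Z(m_1,m_2)}\bigr),$$ where the sum is over the pairs with $m_1m_2=h$ up to simultaneous conjugation, $Z(m_1,m_2)$ is the common centralizer, and $x$ acts on $\otimes^\gamma$ by $\gamma_x(m_1,m_2)\,\rho(x)\otimes\rho'(x)$. The $\beta$-twisted full K-theory $K^\beta_{\rm full}([pt/G])$ is the Grothendieck group (with respect to short exact sequences) of these bundles with the induced product; its unit is the class of the trivial line bundle on the sector of $1$. The representation ring of $D^\beta(k[G])$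 is the Grothendieck group of $\mathrm{Rep}(D^\beta(k[G]))$ with the product induced by $\otimes$. Then: 1. The category of $\beta$-twisted bundles on the inertia stack of $[pt/G]$ carries a braided monoidal structure whose tensor product functor is naturally isomorphic to the push-pull product and whose unit is isomorphic to the trivial line bundle on the sector of $1$, and there is a $k$-linear braided monoidal equivalence $E$ from it to $\mathrm{Rep}(D^\beta(k[G]))$. 2. $E$ induces an isomorphism $K^\beta_{\rm full}([pt/G])\cong \mathrm{Rep}(D^\beta(k[G]))$ of the Grothendieck groups that respects products and units: $[F]\mapsto[E(F)]$. 3. Associativity and commutativity hold in the braided monoidal sense, with associator given by $\beta$: for homogeneous $u_g,v_h,w_l$ in $D^\beta(k[G])$-modules (where $u_g$ has degree $g$ if $(g\lfloor 1)u_g=u_g$), the associativity constraint is $(u_g\otimes v_h)\otimes w_l\mapsto\beta(g,h,l)^{-1}\,u_g\otimes(v_h\otimes w_l)$, and for every vector $v$ the braiding is $u_g\otimes v\mapsto\bigl(\sum_h h\lfloor g\bigr)v\otimes u_g$. The associativity constraint is the canonical rebracketing for all modules if and only if $\beta\equiv1$. -/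

import Mathlib

open scoped TensorProduct
open CategoryTheory MonoidalCategory
universe u

section TwistedDoubleDefs
set_option linter.unusedSimpArgs false
set_option linter.unusedVariables false

/-- A normalized 3-cocycle of the group `G` with values in the (trivial `G`-module) `kˣ`. -/
structure NormalizedCocycle (G k : Type u) [Group G] [Field k] where
  toFun : G → G → G → kˣ
  cocycle : ∀ g h x y,
    toFun h x y * toFun g (h * x) y * toFun g h x = toFun (g * h) x y * toFun g h (x * y)
  one_left : ∀ h x, toFun 1 h x = 1
  one_middle : ∀ g x, toFun g 1 x = 1
  one_right : ∀ g h, toFun g h 1 = 1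

namespace NormalizedCocycle
variable {G k : Type u} [Group G] [Field k] (β : NormalizedCocycle G k)

/-- `θ_g(x,y) = β(g,x,y) β(x,y,(xy)⁻¹g(xy)) / β(x,x⁻¹gx,y)`. -/
def θ (g x y : G) : kˣ :=
  β.toFun g x y * β.toFun x y ((x * y)⁻¹ * g * (x * y)) / β.toFun x (x⁻¹ * g * x) y

/-- `γ_x(g₁,g₂) = β(g₁,g₂,x) β(x,x⁻¹g₁x,x⁻¹g₂x) / β(g₁,x,x⁻¹g₂x)`. -/
def γ (x g h : G) : kˣ :=
  β.toFun g h x * β.toFun x (x⁻¹ * g * x) (x⁻¹ * h * x) / β.toFun g x (x⁻¹ * h * x)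

theorem θ_cocycle (g x y z : G) :
    β.θ g x y * β.θ g (x * y) z = β.θ g x (y * z) * β.θ (x⁻¹ * g * x) y z := by
  have h1 := congrArg Additive.ofMul (β.cocycle g x y z)
  have h2 := congrArg Additive.ofMul (β.cocycle x (x⁻¹ * g * x) y z)
  have h3 := congrArg Additive.ofMul (β.cocycle x y ((x * y)⁻¹ * g * (x * y)) z)
  have h4 := congrArg Additive.ofMul (β.cocycle x y z ((x * y * z)⁻¹ * g * (x * y * z)))
  apply Additive.ofMul.injective
  simp only [θ, ofMul_mul, ofMul_div, mul_assoc, mul_inv_rev, mul_inv_cancel_left,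
    inv_mul_cancel_left] at h1 h2 h3 h4 ⊢
  linear_combination (norm := abel) h1 - h2 + h3 - h4

theorem γ_θ (g h x y : G) :
    β.γ x g h * β.γ y (x⁻¹ * g * x) (x⁻¹ * h * x) * (β.θ g x y * β.θ h x y) =
      β.θ (g * h) x y * β.γ (x * y) g h := by
  have h1 := congrArg Additive.ofMul (β.cocycle g h x y)
  have h2 := congrArg Additive.ofMul (β.cocycle g x (x⁻¹ * h * x) y)
  have h3 := congrArg Additive.ofMul (β.cocycle g x y ((x * y)⁻¹ * h * (x * y)))
  have h4 := congrArg Additive.ofMul (β.cocycle x (x⁻¹ * g * x) (x⁻¹ * h * x) y)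
  have h5 := congrArg Additive.ofMul (β.cocycle x (x⁻¹ * g * x) y ((x * y)⁻¹ * h * (x * y)))
  have h6 := congrArg Additive.ofMul
    (β.cocycle x y ((x * y)⁻¹ * g * (x * y)) ((x * y)⁻¹ * h * (x * y)))
  apply Additive.ofMul.injective
  simp only [θ, γ, ofMul_mul, ofMul_div, mul_assoc, mul_inv_rev, mul_inv_cancel_left,
    inv_mul_cancel_left] at h1 h2 h3 h4 h5 h6 ⊢
  linear_combination (norm := abel) h1 - h2 + h3 + h4 - h5 + h6

theorem γ_assoc (x g h l : G) :
    (β.toFun g h l)⁻¹ * (β.γ x g h * β.γ x (g * h) l) =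
      β.γ x h l * β.γ x g (h * l) *
        (β.toFun (x⁻¹ * g * x) (x⁻¹ * h * x) (x⁻¹ * l * x))⁻¹ := by
  have h1 := congrArg Additive.ofMul (β.cocycle g h l x)
  have h2 := congrArg Additive.ofMul (β.cocycle g h x (x⁻¹ * l * x))
  have h3 := congrArg Additive.ofMul (β.cocycle g x (x⁻¹ * h * x) (x⁻¹ * l * x))
  have h4 := congrArg Additive.ofMul
    (β.cocycle x (x⁻¹ * g * x) (x⁻¹ * h * x) (x⁻¹ * l * x))
  apply Additive.ofMul.injective
  simp only [γ, ofMul_mul, ofMul_div, ofMul_inv, mul_assoc, mul_inv_rev, mul_inv_cancel_left,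
    inv_mul_cancel_left] at h1 h2 h3 h4 ⊢
  linear_combination (norm := abel) h2 - h1 - h3 + h4

@[simp] theorem θ_one_left (g y : G) : β.θ g 1 y = 1 := by
  simp [θ, β.one_left, β.one_middle]

@[simp] theorem θ_one_right (g x : G) : β.θ g x 1 = 1 := by
  simp [θ, β.one_right, β.one_middle]

@[simp] theorem θ_one (x y : G) : β.θ 1 x y = 1 := by
  simp [θ, β.one_left, β.one_right, β.one_middle]

@[simp] theorem γ_one (g h : G) : β.γ 1 g h = 1 := by
  simp [γ, β.one_left, β.one_right, β.one_middle]

@[simp] theorem γ_one_left (x h : G) : β.γ x 1 h = 1 := by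
  simp [γ, β.one_left, β.one_middle]

@[simp] theorem γ_one_right (x g : G) : β.γ x g 1 = 1 := by
  simp [γ, β.one_right, β.one_middle]

theorem γ_braid (x g h : G) :
    β.γ x (x * g * x⁻¹) (x * h * x⁻¹) * β.θ (x * g * h * (x * g)⁻¹) (x * g * x⁻¹) x =
      β.γ x (x * (g * h * g⁻¹) * x⁻¹) (x * g * x⁻¹) * β.θ (x * g * h * (x * g)⁻¹) x g := by
  apply Additive.ofMul.injective
  simp only [θ, γ, ofMul_mul, ofMul_div, mul_assoc, mul_inv_rev, mul_inv_cancel_left,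
    inv_mul_cancel_left, inv_mul_cancel, mul_inv_cancel, mul_one, inv_inv]
  abel

theorem θ_hexagon (g h l : G) :
    β.γ g (g * h * g⁻¹) (g * l * g⁻¹) * β.toFun (g * h * g⁻¹) g l =
      β.toFun (g * h * g⁻¹) (g * l * g⁻¹) g * β.toFun g h l := by
  apply Additive.ofMul.injective
  simp only [θ, γ, ofMul_mul, ofMul_div, mul_assoc, mul_inv_rev, mul_inv_cancel_left,
    inv_mul_cancel_left, inv_mul_cancel, mul_inv_cancel, mul_one, inv_inv]
  abel

theorem θ_hexagon' (g h l : G) :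
    β.θ (g * h * l * (g * h)⁻¹) g h * β.toFun g (h * l * h⁻¹) h =
      β.toFun (g * h * l * (g * h)⁻¹) g h * β.toFun g h l := by
  apply Additive.ofMul.injective
  simp only [θ, γ, ofMul_mul, ofMul_div, mul_assoc, mul_inv_rev, mul_inv_cancel_left,
    inv_mul_cancel_left, inv_mul_cancel, mul_inv_cancel, mul_one, inv_inv]
  abel

end NormalizedCocycle

variable {G k : Type u} [Group G] [Field k]

/-- The twisted Drinfel'd double `D^β(k[G])`: the vector space with basis indexed by pairs
`(g, x)`; the product, coproduct, counit, associator and `R`-matrix follow. -/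
def TwistedDouble (_β : NormalizedCocycle G k) : Type u := G × G →₀ k

namespace TwistedDouble
variable (β : NormalizedCocycle G k)

noncomputable instance : AddCommGroup (TwistedDouble β) := inferInstanceAs (AddCommGroup (G × G →₀ k))

noncomputable instance : Module k (TwistedDouble β) := inferInstanceAs (Module k (G × G →₀ k))

noncomputable def basis : Module.Basis (G × G) k (TwistedDouble β) :=
  (Finsupp.basisSingleOne : Module.Basis (G × G) k (G × G →₀ k))

/-- The basis element with indices `g` and `x` (written `g ⌊ x`). -/
noncomputable def elt (g x : G) : TwistedDouble β := basis β (g, x)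

variable {β} in
theorem induction {p : TwistedDouble β → Prop} (a : TwistedDouble β)
    (zero : p 0) (add : ∀ a b, p a → p b → p (a + b)) (smul : ∀ (c : k) g x, p (c • elt β g x)) :
    p a := by
  refine Finsupp.induction_linear (motive := p) a zero (fun f g hf hg => add f g hf hg) ?_
  intro q c
  have : (Finsupp.single q c : G × G →₀ k) = c • elt β q.1 q.2 := by
    simp [elt, basis]
    exact (Finsupp.smul_single_one q c).symm
  rw [this]
  exact smul c q.1 q.2

open Classical in
/-- The product `(g ⌊ x)(h ⌊ y) = δ_{g, xhx⁻¹} θ_g(x,y) (g ⌊ xy)`, extended bilinearly. -/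
noncomputable def mulLin : TwistedDouble β →ₗ[k] TwistedDouble β →ₗ[k] TwistedDouble β :=
  (basis β).constr k fun p => (basis β).constr k fun q =>
    if p.1 = p.2 * q.1 * p.2⁻¹ then (β.θ p.1 p.2 q.2 : k) • elt β p.1 (p.2 * q.2) else 0

noncomputable instance : Mul (TwistedDouble β) := ⟨fun a b => mulLin β a b⟩

theorem mul_def (a b : TwistedDouble β) : a * b = mulLin β a b := rfl

open Classical in
theorem elt_mul_elt (g x h y : G) : elt β g x * elt β h y =
    if g = x * h * x⁻¹ then (β.θ g x y : k) • elt β g (x * y) else 0 := by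
  change mulLin β (basis β (g, x)) (basis β (h, y)) = _
  simp [mulLin]

noncomputable instance : NonUnitalNonAssocRing (TwistedDouble β) :=
  { (inferInstance : AddCommGroup (TwistedDouble β)), (inferInstance : Mul (TwistedDouble β)) with
    left_distrib := fun a b c => (mulLin β a).map_add b c
    right_distrib := fun a b c => by
      change mulLin β (a + b) c = mulLin β a c + mulLin β b c
      simp
    zero_mul := fun a => by change mulLin β 0 a = 0; simp
    mul_zero := fun a => by change mulLin β a 0 = 0; simp }

theorem smul_mul' (c : k) (a b : TwistedDouble β) : (c • a) * b = c • (a * b) := by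
  simp [mul_def]

theorem mul_smul' (c : k) (a b : TwistedDouble β) : a * (c • b) = c • (a * b) := by
  simp [mul_def]

theorem elt_assoc (g x h y l z : G) :
    elt β g x * elt β h y * elt β l z = elt β g x * (elt β h y * elt β l z) := by
  classical
  have e : g = x * h * x⁻¹ → (g = (x * y) * l * (x * y)⁻¹ ↔ h = y * l * y⁻¹) := by
    rintro rfl
    constructor
    · intro e
      have := congrArg (fun t => x⁻¹ * t * x) e
      simpa [mul_assoc] using this
    · rintro rfl
      simp [mul_assoc]
  rw [elt_mul_elt, elt_mul_elt]
  by_cases h1 : g = x * h * x⁻¹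
  · by_cases h2 : h = y * l * y⁻¹
    · have h3 := (e h1).2 h2
      have h4 : x⁻¹ * g * x = h := by simp [h1, mul_assoc]
      rw [if_pos h1, if_pos h2, smul_mul', mul_smul', elt_mul_elt, elt_mul_elt, if_pos h3,
        if_pos h1, smul_smul, smul_smul, mul_assoc x y z]
      have := β.θ_cocycle g x y z
      rw [h4] at this
      rw [← Units.val_mul, ← Units.val_mul, this, mul_comm]
    · have h3 := fun h => h2 ((e h1).1 h)
      rw [if_pos h1, if_neg h2, smul_mul', elt_mul_elt, if_neg h3, smul_zero, mul_zero]
  · by_cases h2 : h = y * l * y⁻¹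
    · rw [if_neg h1, if_pos h2, mul_smul', elt_mul_elt, if_neg h1, smul_zero, zero_mul]
    · rw [if_neg h1, if_neg h2, zero_mul, mul_zero]

variable [Fintype G]

/-- The unit is `∑_g g ⌊ 1`. -/
noncomputable instance : One (TwistedDouble β) := ⟨∑ g, elt β g 1⟩

theorem one_def : (1 : TwistedDouble β) = ∑ g, elt β g 1 := rfl

noncomputable instance : Ring (TwistedDouble β) :=
  { (inferInstance : NonUnitalNonAssocRing (TwistedDouble β)),
    (inferInstance : One (TwistedDouble β)) with
    mul_assoc := fun a b c => by
      induction a using induction with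
      | zero => simp
      | add a a' h h' => simp only [add_mul, h, h']
      | smul r g x =>
        induction b using induction with
        | zero => simp
        | add a a' h h' => simp only [add_mul, mul_add, h, h']
        | smul r g x =>
          induction c using induction with
          | zero => simp
          | add a a' h h' => simp only [mul_add, h, h']
          | smul r g x => simp only [smul_mul', mul_smul', elt_assoc]
    one_mul := fun a => by
      classical
      induction a using induction with
      | zero => simp
      | add a a' h h' => simp only [mul_add, h, h']
      | smul r g x => simp [one_def, mul_smul', Finset.sum_mul, elt_mul_elt]
    mul_one := fun a => by
      classical
      induction a using induction with
      | zero => simp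
      | add a a' h h' => simp only [add_mul, h, h']
      | smul r g x =>
        have : ∀ h : G, (g = x * h * x⁻¹) ↔ h = x⁻¹ * g * x := fun h =>
          ⟨fun e => by simp [e, mul_assoc], fun e => by simp [e, mul_assoc]⟩
        simp [one_def, smul_mul', Finset.mul_sum, elt_mul_elt, this] }

noncomputable instance : Algebra k (TwistedDouble β) :=
  Algebra.ofModule (smul_mul' β) (mul_smul' β)

/-- The coproduct `Δ(g ⌊ x) = ∑_{g₁g₂ = g} γ_x(g₁,g₂) (g₁ ⌊ x) ⊗ (g₂ ⌊ x)`; the sum is indexed by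
`g₁ = h`, `g₂ = h⁻¹g`. -/
noncomputable def comulLin :
    TwistedDouble β →ₗ[k] TwistedDouble β ⊗[k] TwistedDouble β :=
  (basis β).constr k fun p =>
    ∑ h : G, (β.γ p.2 h (h⁻¹ * p.1) : k) • (elt β h p.2 ⊗ₜ[k] elt β (h⁻¹ * p.1) p.2)

theorem comulLin_elt (g x : G) : comulLin β (elt β g x) =
    ∑ h : G, (β.γ x h (h⁻¹ * g) : k) • (elt β h x ⊗ₜ[k] elt β (h⁻¹ * g) x) := by
  change comulLin β (basis β (g, x)) = _
  rw [comulLin, Module.Basis.constr_basis]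

/-- The coproduct as an algebra homomorphism. -/
noncomputable def comul :
    TwistedDouble β →ₐ[k] TwistedDouble β ⊗[k] TwistedDouble β :=
  AlgHom.ofLinearMap (comulLin β)
    (by
      simp only [one_def, map_sum, comulLin_elt, NormalizedCocycle.γ_one,
        Algebra.TensorProduct.one_def, TensorProduct.sum_tmul, TensorProduct.tmul_sum,
        Units.val_one, one_smul]
      rw [Finset.sum_comm]
      conv_rhs => rw [Finset.sum_comm]
      refine Finset.sum_congr rfl fun h _ => ?_
      exact Fintype.sum_equiv (Equiv.mulLeft h⁻¹) _ _ fun g => rfl)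
    (by
      have key : ∀ g x h y : G, comulLin β (elt β g x * elt β h y) =
          comulLin β (elt β g x) * comulLin β (elt β h y) := by
        classical
        intro g x h y
        simp only [comulLin_elt, Finset.sum_mul, Finset.mul_sum, smul_mul_assoc, mul_smul_comm,
          Algebra.TensorProduct.tmul_mul_tmul, elt_mul_elt, Finset.smul_sum]
        rw [Finset.sum_comm]
        by_cases e : g = x * h * x⁻¹
        · have e1 : ∀ a b : G, a⁻¹ * g = x * (b⁻¹ * h) * x⁻¹ ↔ a = x * b * x⁻¹ := by
            intro a b
            subst e
            constructor
            · intro e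
              have : a⁻¹ = x * b⁻¹ * x⁻¹ := by
                have := congrArg (fun t => t * (x * h⁻¹ * x⁻¹)) e
                simpa [mul_assoc] using this
              rw [← inv_inj, this]; simp [mul_assoc]
            · rintro rfl; simp [mul_assoc]
          have e2 : ∀ a b : G, a = x * b * x⁻¹ ↔ b = x⁻¹ * a * x := fun a b =>
            ⟨fun e => by simp [e, mul_assoc], fun e => by simp [e, mul_assoc]⟩
          simp only [if_pos e, e1]
          rw [map_smul, comulLin_elt, Finset.smul_sum]
          refine Finset.sum_congr rfl fun a _ => ?_
          have e3 : ∀ b : G, (β.γ x a (a⁻¹ * g) : k) • (β.γ y b (b⁻¹ * h) : k) •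
              ((if a = x * b * x⁻¹ then (β.θ a x y : k) • elt β a (x * y) else 0) ⊗ₜ[k]
              (if a = x * b * x⁻¹ then (β.θ (a⁻¹ * g) x y : k) • elt β (a⁻¹ * g) (x * y) else 0))
              = if b = x⁻¹ * a * x then (β.θ g x y : k) • (β.γ (x * y) a (a⁻¹ * g) : k) •
                (elt β a (x * y) ⊗ₜ[k] elt β (a⁻¹ * g) (x * y)) else 0 := by
            intro b
            by_cases hb : b = x⁻¹ * a * x
            · have hb' := (e2 a b).2 hb
              simp only [if_pos hb, if_pos hb', TensorProduct.smul_tmul_smul, smul_smul]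
              congr 1
              have h1 := β.γ_θ a (a⁻¹ * g) x y
              have h2 : b⁻¹ * h = x⁻¹ * (a⁻¹ * g) * x := by
                subst hb; subst e; simp [mul_assoc]
              rw [h2, hb]
              rw [mul_inv_cancel_left] at h1
              simpa only [Units.val_mul, mul_assoc] using congrArg Units.val h1
            · have hb' := fun h => hb ((e2 a b).1 h)
              simp [if_neg hb, if_neg hb']
          simp only [smul_comm (β.γ y _ _ : k), e3]
          simp [e3]
        · rw [if_neg e, map_zero]
          symm
          refine Finset.sum_eq_zero fun a _ => Finset.sum_eq_zero fun b _ => ?_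
          by_cases h1 : a = x * b * x⁻¹
          · have h2 : ¬ (a⁻¹ * g = x * (b⁻¹ * h) * x⁻¹) := by
              intro h2
              apply e
              rw [inv_mul_eq_iff_eq_mul] at h2
              rw [h2, h1]; simp [mul_assoc]
            simp [if_neg h2]
          · simp [if_neg h1]
      intro a b
      induction a using induction with
      | zero => simp
      | add a a' h h' => simp only [add_mul, map_add, h, h']
      | smul r g x =>
        induction b using induction with
        | zero => simp
        | add a a' h h' => simp only [mul_add, map_add, h, h']
        | smul r g x => simp only [smul_mul_assoc, mul_smul_comm, map_smul, key])

theorem comul_elt (g x : G) : comul β (elt β g x) =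
    ∑ h : G, (β.γ x h (h⁻¹ * g) : k) • (elt β h x ⊗ₜ[k] elt β (h⁻¹ * g) x) :=
  comulLin_elt β g x

open Classical in
/-- The counit `ε(g ⌊ x) = δ_{g,1}`. -/
noncomputable def counitLin : TwistedDouble β →ₗ[k] k :=
  (basis β).constr k fun p => if p.1 = 1 then 1 else 0

open Classical in
theorem counitLin_elt (g x : G) : counitLin β (elt β g x) = if g = 1 then 1 else 0 := by
  change counitLin β (basis β (g, x)) = _
  rw [counitLin, Module.Basis.constr_basis]

/-- The counit as an algebra homomorphism. -/
noncomputable def counit : TwistedDouble β →ₐ[k] k :=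
  AlgHom.ofLinearMap (counitLin β) (by classical simp [one_def, counitLin_elt]) (by
    classical
    intro a b
    induction a using induction with
    | zero => simp
    | add a a' h h' => simp only [add_mul, map_add, h, h']
    | smul r g x =>
      induction b using induction with
      | zero => simp
      | add a a' h h' => simp only [mul_add, map_add, h, h']
      | smul r' h y =>
        simp only [smul_mul_assoc, mul_smul_comm, map_smul, counitLin_elt, elt_mul_elt]
        by_cases e : g = 1
        · subst e
          have : (1 = x * h * x⁻¹) ↔ h = 1 := by
            rw [eq_comm, mul_inv_eq_one, mul_eq_left]
          by_cases e : h = 1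
          · simp [e, counitLin_elt]
          · simp [e, this]
        · split_ifs <;> simp [e, counitLin_elt])

/-- The associator `Φ = ∑ β(g,h,l)⁻¹ (g ⌊ 1) ⊗ (h ⌊ 1) ⊗ (l ⌊ 1)`. -/
noncomputable def Φ : TwistedDouble β ⊗[k] (TwistedDouble β ⊗[k] TwistedDouble β) :=
  ∑ g : G, ∑ h : G, ∑ l : G,
    ((β.toFun g h l)⁻¹ : kˣ).val • (elt β g 1 ⊗ₜ[k] (elt β h 1 ⊗ₜ[k] elt β l 1))

/-- The element `𝟏 ⌊ x = ∑_h h ⌊ x`. -/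
noncomputable def sumElt (x : G) : TwistedDouble β := ∑ h : G, elt β h x

/-- The `R`-matrix `R = ∑_g (g ⌊ 1) ⊗ (𝟏 ⌊ g)`. -/
noncomputable def R : TwistedDouble β ⊗[k] TwistedDouble β :=
  ∑ g : G, elt β g 1 ⊗ₜ[k] sumElt β g

end TwistedDouble

/-- A finite-dimensional left `D^β(k[G])`-module. -/
structure RepDouble [Fintype G] (β : NormalizedCocycle G k) where
  V : Type u
  [addCommGroup : AddCommGroup V]
  [module : Module k V]
  [finiteDimensional : FiniteDimensional k V]
  ρ : TwistedDouble β →ₐ[k] Module.End k V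

namespace RepDouble
open TwistedDouble
variable [Fintype G] {β : NormalizedCocycle G k}
attribute [instance] addCommGroup module finiteDimensional

/-- A homomorphism of `D^β(k[G])`-modules. -/
@[ext]
structure Hom (A B : RepDouble β) where
  lin : A.V →ₗ[k] B.V
  comm : ∀ a v, lin (A.ρ a v) = B.ρ a (lin v)

instance : Category (RepDouble β) where
  Hom := Hom
  id A := ⟨LinearMap.id, fun _ _ => rfl⟩
  comp f g := ⟨g.lin ∘ₗ f.lin, fun a v => by simp [f.comm, g.comm]⟩

@[ext]

theorem hom_ext {A B : RepDouble β} {f g : A ⟶ B} (h : f.lin = g.lin) : f = g := Hom.ext h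

@[simp] theorem id_lin (A : RepDouble β) : Hom.lin (𝟙 A) = LinearMap.id := rfl

@[simp] theorem comp_lin {A B C : RepDouble β} (f : A ⟶ B) (g : B ⟶ C) :
    (f ≫ g).lin = g.lin ∘ₗ f.lin := rfl

/-- `v` lies in the degree `g` part `A_g`, the image of the projector `ρ(g ⌊ 1)`. -/
def Homog (A : RepDouble β) (g : G) (v : A.V) : Prop := A.ρ (elt β g 1) v = v

/-- `φ(x) = ρ(𝟏 ⌊ x)`. -/
noncomputable def φ (A : RepDouble β) (x : G) : Module.End k A.V := A.ρ (sumElt β x)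

theorem homog_proj (A : RepDouble β) (g : G) (v : A.V) : A.Homog g (A.ρ (elt β g 1) v) := by
  change (A.ρ _ * A.ρ _) v = _
  rw [← map_mul, elt_mul_elt]
  simp

theorem sum_proj (A : RepDouble β) (v : A.V) : ∑ g : G, A.ρ (elt β g 1) v = v := by
  rw [← LinearMap.sum_apply, ← map_sum, ← one_def, map_one]; rfl

open Classical in
theorem ρ_homog {A : RepDouble β} {h : G} {v : A.V} (hv : A.Homog h v) (g x : G) :
    A.ρ (elt β g x) v = if g = x * h * x⁻¹ then A.φ x v else 0 := by
  have key : ∀ g, A.ρ (elt β g x) v = if g = x * h * x⁻¹ then A.ρ (elt β g x) v else 0 := by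
    intro g
    conv_lhs => rw [← hv]
    change (A.ρ _ * A.ρ _) v = _
    rw [← map_mul, elt_mul_elt]
    split_ifs <;> simp
  rw [key]
  split_ifs with e
  · subst e
    rw [φ, sumElt, map_sum, LinearMap.sum_apply]
    rw [Finset.sum_congr rfl fun g _ => key g]
    simp
  · rfl

theorem homog_proj_eq {A : RepDouble β} {h : G} {v : A.V} (hv : A.Homog h v) [DecidableEq G]
    (g : G) : A.ρ (elt β g 1) v = if g = h then v else 0 := by
  classical
  split_ifs with e
  · rw [e]; exact hv
  · rw [ρ_homog hv, if_neg]
    simpa using e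

theorem homog_φ {A : RepDouble β} {h : G} {v : A.V} (hv : A.Homog h v) (x : G) :
    A.Homog (x * h * x⁻¹) (A.φ x v) := by
  classical
  have := ρ_homog hv (x * h * x⁻¹) x
  rw [if_pos rfl] at this
  rw [← this, Homog]
  change (A.ρ _ * A.ρ _) v = _
  rw [← map_mul, elt_mul_elt]
  simp

theorem φ_φ {A : RepDouble β} {h : G} {v : A.V} (hv : A.Homog h v) (x y : G) :
    A.φ x (A.φ y v) = (β.θ (x * y * h * (x * y)⁻¹) x y : k) • A.φ (x * y) v := by
  classical
  have h1 := ρ_homog hv (y * h * y⁻¹) y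
  have h2 := ρ_homog (homog_φ hv y) (x * (y * h * y⁻¹) * x⁻¹) x
  have h3 := ρ_homog hv (x * y * h * (x * y)⁻¹) (x * y)
  rw [if_pos rfl] at h1 h2 h3
  rw [← h2, ← h1, ← h3]
  change (A.ρ _ * A.ρ _) v = _
  have e : x * (y * h * y⁻¹) * x⁻¹ = x * y * h * (x * y)⁻¹ := by simp [mul_assoc]
  rw [← map_mul, elt_mul_elt, if_pos rfl, e, map_smul]
  rfl

theorem φ_one {A : RepDouble β} (v : A.V) : A.φ 1 v = v := by
  rw [φ, sumElt, ← one_def, map_one]; rfl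

theorem hom_φ {A B : RepDouble β} (f : A ⟶ B) (x : G) (v : A.V) :
    f.lin (A.φ x v) = B.φ x (f.lin v) := f.comm _ _

theorem Homog.map {A B : RepDouble β} (f : A ⟶ B) {g : G} {v : A.V} (h : A.Homog g v) :
    B.Homog g (f.lin v) := by
  rw [Homog, ← f.comm, h]

/-- Linear maps that agree on homogeneous elements agree. -/
theorem lin_ext {A : RepDouble β} {M : Type u} [AddCommGroup M] [Module k M]
    {f f' : A.V →ₗ[k] M} (h : ∀ g v, A.Homog g v → f v = f' v) : f = f' := by
  ext v
  rw [← A.sum_proj v, map_sum, map_sum]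
  exact Finset.sum_congr rfl fun g _ => h g _ (A.homog_proj g v)

theorem lin_ext₂ {A B : RepDouble β} {M : Type u} [AddCommGroup M] [Module k M]
    {f f' : A.V ⊗[k] B.V →ₗ[k] M}
    (h : ∀ g v h w, A.Homog g v → B.Homog h w → f (v ⊗ₜ w) = f' (v ⊗ₜ w)) : f = f' := by
  apply TensorProduct.ext
  refine lin_ext fun g v hv => lin_ext fun h' w hw => ?_
  exact h g v h' w hv hw

theorem lin_ext₃ {A B C : RepDouble β} {M : Type u} [AddCommGroup M] [Module k M]
    {f f' : (A.V ⊗[k] B.V) ⊗[k] C.V →ₗ[k] M}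
    (h : ∀ g v h w l x, A.Homog g v → B.Homog h w → C.Homog l x →
      f ((v ⊗ₜ w) ⊗ₜ x) = f' ((v ⊗ₜ w) ⊗ₜ x)) : f = f' := by
  apply TensorProduct.ext
  refine lin_ext₂ fun g v h' w hv hw => lin_ext fun l x hx => ?_
  exact h g v h' w l x hv hw hx

theorem lin_ext₃' {A B C : RepDouble β} {M : Type u} [AddCommGroup M] [Module k M]
    {f f' : A.V ⊗[k] (B.V ⊗[k] C.V) →ₗ[k] M}
    (h : ∀ g v h w l x, A.Homog g v → B.Homog h w → C.Homog l x →
      f (v ⊗ₜ (w ⊗ₜ x)) = f' (v ⊗ₜ (w ⊗ₜ x))) : f = f' := by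
  apply TensorProduct.ext
  refine lin_ext fun g v hv => lin_ext₂ fun h' w l x hw hx => ?_
  exact h g v h' w l x hv hw hx

theorem lin_ext₄ {A B C D : RepDouble β} {M : Type u} [AddCommGroup M] [Module k M]
    {f f' : ((A.V ⊗[k] B.V) ⊗[k] C.V) ⊗[k] D.V →ₗ[k] M}
    (h : ∀ g v h w l x m y, A.Homog g v → B.Homog h w → C.Homog l x → D.Homog m y →
      f (((v ⊗ₜ w) ⊗ₜ x) ⊗ₜ y) = f' (((v ⊗ₜ w) ⊗ₜ x) ⊗ₜ y)) : f = f' := by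
  apply TensorProduct.ext
  refine lin_ext₃ fun g v h' w l x hv hw hx => lin_ext fun m y hy => ?_
  exact h g v h' w l x m y hv hw hx hy

/-- A linear map that commutes with all basis elements is a homomorphism. -/
def mkHom {A B : RepDouble β} (f : A.V →ₗ[k] B.V)
    (h : ∀ g x v, f (A.ρ (elt β g x) v) = B.ρ (elt β g x) (f v)) : A ⟶ B where
  lin := f
  comm a v := by
    induction a using induction with
    | zero => simp
    | add a b ha hb => simp [ha, hb]
    | smul c g x => simp [h]

/-- The action of `D ⊗ D` on `A ⊗ B`. -/
noncomputable def actTwo (A B : RepDouble β) :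
    TwistedDouble β ⊗[k] TwistedDouble β →ₐ[k] Module.End k (A.V ⊗[k] B.V) :=
  (Module.endTensorEndAlgHom (R := k) (S := k) (A := k)).comp
    (Algebra.TensorProduct.map A.ρ B.ρ)

theorem actTwo_tmul (A B : RepDouble β) (a b : TwistedDouble β) :
    actTwo A B (a ⊗ₜ b) = TensorProduct.map (A.ρ a) (B.ρ b) := rfl

/-- The action of `D ⊗ (D ⊗ D)` on `A ⊗ (B ⊗ C)`. -/
noncomputable def actThree (A B C : RepDouble β) :
    TwistedDouble β ⊗[k] (TwistedDouble β ⊗[k] TwistedDouble β) →ₐ[k]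
      Module.End k (A.V ⊗[k] (B.V ⊗[k] C.V)) :=
  (Module.endTensorEndAlgHom (R := k) (S := k) (A := k)).comp
    (Algebra.TensorProduct.map A.ρ (actTwo B C))

theorem actThree_tmul (A B C : RepDouble β) (a b c : TwistedDouble β) :
    actThree A B C (a ⊗ₜ (b ⊗ₜ c)) =
      TensorProduct.map (A.ρ a) (TensorProduct.map (B.ρ b) (C.ρ c)) := rfl

/-- The tensor product of modules: `D^β(k[G])` acts through `Δ`. -/
noncomputable abbrev tensor (A B : RepDouble β) : RepDouble β where
  V := A.V ⊗[k] B.V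
  ρ := (actTwo A B).comp (comul β)

/-- The unit module: `k` with `D^β(k[G])` acting through `ε`. -/
noncomputable abbrev unit (β : NormalizedCocycle G k) : RepDouble β where
  V := k
  ρ := (Algebra.lmul k k).comp (counit β)

theorem tensor_ρ_elt {A B : RepDouble β} (a b x : G) (v : A.V) (w : B.V)
    (hv : A.Homog a v) (hw : B.Homog b w) (g : G) [DecidableEq G] :
    (tensor A B).ρ (elt β g x) (v ⊗ₜ[k] w) =
      if g = x * (a * b) * x⁻¹ then
        (β.γ x (x * a * x⁻¹) (x * b * x⁻¹) : k) • (A.φ x v ⊗ₜ[k] B.φ x w) else 0 := by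
  classical
  change actTwo A B (comul β (elt β g x)) (v ⊗ₜ[k] w) = _
  simp only [comul_elt, map_sum, map_smul, actTwo_tmul, LinearMap.sum_apply,
    LinearMap.smul_apply, TensorProduct.map_tmul, ρ_homog hv, ρ_homog hw]
  have e : (x * a * x⁻¹)⁻¹ * g = x * b * x⁻¹ ↔ g = x * (a * b) * x⁻¹ := by
    rw [inv_mul_eq_iff_eq_mul]; simp [mul_assoc]
  rw [Finset.sum_eq_single (x * a * x⁻¹)]
  · by_cases h : g = x * (a * b) * x⁻¹
    · rw [if_pos rfl, if_pos (e.2 h), if_pos h, e.2 h]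
    · rw [if_neg (fun h' => h (e.1 h')), if_neg h]; simp
  · intro c _ hc
    simp [if_neg hc]
  · simp

theorem Homog.tensor {A B : RepDouble β} {a b : G} {v : A.V} {w : B.V}
    (hv : A.Homog a v) (hw : B.Homog b w) : (tensor A B).Homog (a * b) (v ⊗ₜ[k] w) := by
  classical
  have := tensor_ρ_elt a b 1 v w hv hw (a * b)
  refine this.trans ?_
  simp [φ_one]

theorem tensor_φ {A B : RepDouble β} {a b x : G} {v : A.V} {w : B.V}
    (hv : A.Homog a v) (hw : B.Homog b w) :
    (RepDouble.tensor A B).φ x (v ⊗ₜ[k] w) =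
        (β.γ x (x * a * x⁻¹) (x * b * x⁻¹) : k) • (A.φ x v ⊗ₜ[k] B.φ x w) := by
  classical
  have := tensor_ρ_elt a b x v w hv hw (x * (a * b) * x⁻¹)
  rw [if_pos rfl] at this
  rw [← this, ρ_homog (hv.tensor hw), if_pos rfl]

theorem homog_unit (a : k) : (unit β).Homog 1 (show k from a) := by
  change counit β (elt β 1 1) * a = a
  rw [show counit β (elt β 1 1) = 1 by
    exact (counitLin_elt β 1 1).trans (if_pos rfl), one_mul]

theorem unit_φ (a : k) (x : G) : (unit β).φ x (show k from a) = a := by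
  classical
  have := ρ_homog (homog_unit (β := β) a) 1 x
  rw [if_pos (by simp)] at this
  rw [← this]
  change counit β (elt β 1 x) * a = a
  rw [show counit β (elt β 1 x) = 1 by
    exact (counitLin_elt β 1 x).trans (if_pos rfl), one_mul]

/-- Commutation with `φ` on a homogeneous vector gives commutation with the basis elements. -/
theorem comm_of_homog {A B : RepDouble β} (f : A.V →ₗ[k] B.V) {g : G} {v : A.V}
    (hv : A.Homog g v) (hfv : B.Homog g (f v)) (h : ∀ x, f (A.φ x v) = B.φ x (f v)) (a x : G) :
    f (A.ρ (elt β a x) v) = B.ρ (elt β a x) (f v) := by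
  classical
  rw [ρ_homog hv, ρ_homog hfv]
  split_ifs
  · exact h x
  · simp

/-- The associativity constraint `(u ⊗ v) ⊗ w ↦ Φ (u ⊗ (v ⊗ w))`. -/
noncomputable def assocLin (A B C : RepDouble β) :
    (A.V ⊗[k] B.V) ⊗[k] C.V →ₗ[k] A.V ⊗[k] (B.V ⊗[k] C.V) :=
  actThree A B C (Φ β) ∘ₗ (TensorProduct.assoc k A.V B.V C.V).toLinearMap

theorem actThree_diag {A B C : RepDouble β} (c : G → G → G → kˣ) {g h l : G}
    {u : A.V} {v : B.V} {w : C.V} (hu : A.Homog g u) (hv : B.Homog h v) (hw : C.Homog l w) :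
    actThree A B C (∑ g : G, ∑ h : G, ∑ l : G,
      (c g h l).val • (elt β g 1 ⊗ₜ[k] (elt β h 1 ⊗ₜ[k] elt β l 1))) (u ⊗ₜ[k] (v ⊗ₜ[k] w)) =
      (c g h l : k) • (u ⊗ₜ[k] (v ⊗ₜ[k] w)) := by
  classical
  simp only [map_sum, map_smul, actThree_tmul, LinearMap.sum_apply,
    LinearMap.smul_apply, TensorProduct.map_tmul, homog_proj_eq hu, homog_proj_eq hv,
    homog_proj_eq hw]
  rw [Finset.sum_eq_single g, Finset.sum_eq_single h, Finset.sum_eq_single l] <;>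
    simp +contextual

theorem assocLin_homog {A B C : RepDouble β} {g h l : G}
    {u : A.V} {v : B.V} {w : C.V} (hu : A.Homog g u) (hv : B.Homog h v) (hw : C.Homog l w) :
    assocLin A B C ((u ⊗ₜ[k] v) ⊗ₜ[k] w) =
      ((β.toFun g h l)⁻¹ : kˣ).val • (u ⊗ₜ[k] (v ⊗ₜ[k] w)) :=
  actThree_diag (fun g h l => (β.toFun g h l)⁻¹) hu hv hw

/-- The inverse of the associativity constraint. -/
noncomputable def assocInvLin (A B C : RepDouble β) :
    A.V ⊗[k] (B.V ⊗[k] C.V) →ₗ[k] (A.V ⊗[k] B.V) ⊗[k] C.V :=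
  (TensorProduct.assoc k A.V B.V C.V).symm.toLinearMap ∘ₗ
    actThree A B C (∑ g : G, ∑ h : G, ∑ l : G,
      (β.toFun g h l).val • (elt β g 1 ⊗ₜ[k] (elt β h 1 ⊗ₜ[k] elt β l 1)))

theorem assocInvLin_homog {A B C : RepDouble β} {g h l : G}
    {u : A.V} {v : B.V} {w : C.V} (hu : A.Homog g u) (hv : B.Homog h v) (hw : C.Homog l w) :
    assocInvLin A B C (u ⊗ₜ[k] (v ⊗ₜ[k] w)) =
      (β.toFun g h l : k) • ((u ⊗ₜ[k] v) ⊗ₜ[k] w) := by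
  have := actThree_diag β.toFun hu hv hw
  rw [assocInvLin, LinearMap.comp_apply, this]
  simp

/-- The associativity constraint as a homomorphism of modules. -/
noncomputable def assocHom (A B C : RepDouble β) :
    tensor (tensor A B) C ⟶ tensor A (tensor B C) :=
  mkHom (A := tensor (tensor A B) C) (B := tensor A (tensor B C)) (assocLin A B C) (by
    intro a x v
    refine LinearMap.congr_fun (f := assocLin A B C ∘ₗ (tensor (tensor A B) C).ρ (elt β a x))
      (g := (tensor A (tensor B C)).ρ (elt β a x) ∘ₗ assocLin A B C) ?_ v
    refine lin_ext₃ fun g u h v l w hu hv hw => ?_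
    refine comm_of_homog (A := tensor (tensor A B) C) (B := tensor A (tensor B C))
      (assocLin A B C) ((hu.tensor hv).tensor hw) ?_ ?_ a x
    · rw [assocLin_homog hu hv hw, mul_assoc, Homog, map_smul]
      exact congrArg _ (hu.tensor (hv.tensor hw))
    · intro x
      rw [assocLin_homog hu hv hw, map_smul, tensor_φ (hu.tensor hv) hw, tensor_φ hu hv,
        tensor_φ hu (hv.tensor hw), tensor_φ hv hw]
      simp only [← TensorProduct.smul_tmul', TensorProduct.tmul_smul, map_smul]
      have hA := assocLin_homog (homog_φ hu x) (homog_φ hv x) (homog_φ hw x)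
      rw [hA]
      simp only [smul_smul]
      congr 1
      have := congrArg Units.val (β.γ_assoc x (x * g * x⁻¹) (x * h * x⁻¹) (x * l * x⁻¹))
      simp only [mul_assoc, inv_mul_cancel_left, inv_mul_cancel, mul_one, Units.val_mul] at this ⊢
      linear_combination this)

/-- A homomorphism with a linear inverse is an isomorphism. -/
def mkIso {A B : RepDouble β} (f : A ⟶ B) (g : B.V →ₗ[k] A.V) (h1 : g ∘ₗ f.lin = LinearMap.id)
    (h2 : f.lin ∘ₗ g = LinearMap.id) : A ≅ B where
  hom := f
  inv := ⟨g, fun a v => by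
    have e1 : ∀ v, g (f.lin v) = v := LinearMap.congr_fun h1
    have e2 : ∀ v, f.lin (g v) = v := LinearMap.congr_fun h2
    have := congrArg g (f.comm a (g v))
    rw [e1, e2] at this
    exact this.symm⟩
  hom_inv_id := hom_ext h1
  inv_hom_id := hom_ext h2

/-- The associativity constraint. -/
noncomputable def assoc (A B C : RepDouble β) :
    tensor (tensor A B) C ≅ tensor A (tensor B C) :=
  mkIso (assocHom A B C) (assocInvLin A B C)
    (by
      refine lin_ext₃ fun g u h v l w hu hv hw => ?_
      change assocInvLin A B C (assocLin A B C _) = _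
      rw [assocLin_homog hu hv hw, map_smul, assocInvLin_homog hu hv hw, smul_smul]
      simp)
    (by
      refine lin_ext₃' fun g u h v l w hu hv hw => ?_
      change assocLin A B C (assocInvLin A B C _) = _
      rw [assocInvLin_homog hu hv hw, map_smul, assocLin_homog hu hv hw, smul_smul]
      simp)

/-- The left unit constraint `c ⊗ v ↦ c v`. -/
noncomputable def leftUnit (A : RepDouble β) : tensor (unit β) A ≅ A :=
  mkIso (mkHom (A := tensor (unit β) A) (TensorProduct.lid k A.V).toLinearMap (by
    intro a x v
    refine LinearMap.congr_fun
      (f := (TensorProduct.lid k A.V).toLinearMap ∘ₗ (tensor (unit β) A).ρ (elt β a x))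
      (g := A.ρ (elt β a x) ∘ₗ (TensorProduct.lid k A.V).toLinearMap) ?_ v
    apply TensorProduct.ext
    ext1
    refine lin_ext fun g v hv => ?_
    have h1 := homog_unit (β := β) 1
    refine comm_of_homog (A := tensor (unit β) A) (B := A) (TensorProduct.lid k A.V).toLinearMap
      (h1.tensor hv) ?_ ?_ a x
    · simpa using hv
    · intro x
      rw [tensor_φ h1 hv, unit_φ]
      simp)) (TensorProduct.lid k A.V).symm.toLinearMap
    (by ext : 1; simp [mkHom]) (by ext : 1; simp [mkHom])

/-- The right unit constraint `v ⊗ c ↦ c v`. -/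
noncomputable def rightUnit (A : RepDouble β) : tensor A (unit β) ≅ A :=
  mkIso (mkHom (A := tensor A (unit β)) (TensorProduct.rid k A.V).toLinearMap (by
    intro a x v
    refine LinearMap.congr_fun
      (f := (TensorProduct.rid k A.V).toLinearMap ∘ₗ (tensor A (unit β)).ρ (elt β a x))
      (g := A.ρ (elt β a x) ∘ₗ (TensorProduct.rid k A.V).toLinearMap) ?_ v
    apply TensorProduct.ext
    refine lin_ext fun g v hv => ?_
    ext1
    have h1 := homog_unit (β := β) 1
    refine comm_of_homog (A := tensor A (unit β)) (B := A) (TensorProduct.rid k A.V).toLinearMap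
      (hv.tensor h1) ?_ ?_ a x
    · simpa using hv
    · intro x
      rw [tensor_φ hv h1, unit_φ]
      simp)) (TensorProduct.rid k A.V).symm.toLinearMap
    (by ext : 1; simp [mkHom]) (by ext : 1; simp [mkHom])

theorem actTwo_naturality {A A' B B' : RepDouble β} (f : A ⟶ A') (g : B ⟶ B')
    (t : TwistedDouble β ⊗[k] TwistedDouble β) (v : A.V ⊗[k] B.V) :
    TensorProduct.map f.lin g.lin (actTwo A B t v) =
      actTwo A' B' t (TensorProduct.map f.lin g.lin v) := by
  induction t using TensorProduct.induction_on with
  | zero => simp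
  | add t t' h h' => simp [h, h']
  | tmul a b =>
    refine LinearMap.congr_fun (f := TensorProduct.map f.lin g.lin ∘ₗ actTwo A B (a ⊗ₜ b))
      (g := actTwo A' B' (a ⊗ₜ b) ∘ₗ TensorProduct.map f.lin g.lin) ?_ v
    ext v w
    simp [actTwo_tmul, f.comm, g.comm]

/-- The tensor product of homomorphisms. -/
noncomputable def tensorHom {A A' B B' : RepDouble β} (f : A ⟶ A') (g : B ⟶ B') :
    tensor A B ⟶ tensor A' B' where
  lin := TensorProduct.map f.lin g.lin
  comm a v := actTwo_naturality f g (comul β a) v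

noncomputable instance : MonoidalCategoryStruct (RepDouble β) where
  tensorObj := tensor
  tensorUnit := unit β
  tensorHom := tensorHom
  whiskerLeft A _ _ g := tensorHom (𝟙 A) g
  whiskerRight f B := tensorHom f (𝟙 B)
  associator := assoc
  leftUnitor := leftUnit
  rightUnitor := rightUnit

/-- The modules over `D^β(k[G])` form a monoidal category. -/
noncomputable instance : MonoidalCategory (RepDouble β) :=
  MonoidalCategory.ofTensorHom
    (id_tensorHom_id := fun A B => hom_ext TensorProduct.map_id)
    (tensorHom_comp_tensorHom := fun f₁ f₂ g₁ g₂ => hom_ext (by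
      exact (TensorProduct.map_comp _ _ _ _).symm))
    (associator_naturality := fun {A B C A' B' C'} f g h => hom_ext (by
      refine lin_ext₃ fun a u b v c w hu hv hw => ?_
      change assocLin A' B' C' ((f.lin u ⊗ₜ g.lin v) ⊗ₜ h.lin w) =
        TensorProduct.map f.lin (TensorProduct.map g.lin h.lin) (assocLin A B C _)
      rw [assocLin_homog hu hv hw, assocLin_homog (hu.map f) (hv.map g) (hw.map h)]
      simp))
    (leftUnitor_naturality := fun {A B} f => hom_ext (by
      apply TensorProduct.ext'
      intro c v
      exact (f.lin.map_smul c v).symm))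
    (rightUnitor_naturality := fun {A B} f => hom_ext (by
      apply TensorProduct.ext'
      intro v c
      exact (f.lin.map_smul c v).symm))
    (pentagon := fun A B C D => hom_ext (by
      refine lin_ext₄ fun a u b v c w d x hu hv hw hx => ?_
      change TensorProduct.map LinearMap.id (assocLin B C D) (assocLin A (tensor B C) D
        (TensorProduct.map (assocLin A B C) LinearMap.id (((u ⊗ₜ v) ⊗ₜ w) ⊗ₜ x))) =
        assocLin A B (tensor C D) (assocLin (tensor A B) C D (((u ⊗ₜ v) ⊗ₜ w) ⊗ₜ x))
      rw [TensorProduct.map_tmul, assocLin_homog hu hv hw, ← TensorProduct.smul_tmul', map_smul,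
        LinearMap.id_apply, assocLin_homog hu (hv.tensor hw) hx, map_smul, map_smul,
        TensorProduct.map_tmul, assocLin_homog hv hw hx, assocLin_homog (hu.tensor hv) hw hx,
        map_smul, assocLin_homog hu hv (hw.tensor hx), TensorProduct.tmul_smul, smul_smul,
        smul_smul, smul_smul]
      have := congrArg (fun t => (t⁻¹ : kˣ).val) (β.cocycle a b c d)
      simp only [mul_inv, Units.val_mul] at this
      congr 1
      linear_combination this))
    (triangle := fun A B => hom_ext (by
      apply TensorProduct.ext
      apply TensorProduct.ext
      refine lin_ext fun a u hu => ?_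
      ext1
      refine lin_ext fun b v hv => ?_
      have h1 := homog_unit (β := β) 1
      change TensorProduct.map LinearMap.id (TensorProduct.lid k B.V).toLinearMap
        (assocLin A (unit β) B ((u ⊗ₜ (1 : k)) ⊗ₜ v)) =
        TensorProduct.map (TensorProduct.rid k A.V).toLinearMap LinearMap.id ((u ⊗ₜ (1 : k)) ⊗ₜ v)
      rw [assocLin_homog hu h1 hv]
      simp [β.one_middle]))

/-- The braiding `u ⊗ v ↦ τ (R (u ⊗ v))`, where `τ` is the flip. -/
noncomputable def braidLin (A B : RepDouble β) : A.V ⊗[k] B.V →ₗ[k] B.V ⊗[k] A.V :=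
  (TensorProduct.comm k A.V B.V).toLinearMap ∘ₗ actTwo A B (R β)

theorem braidLin_homog {A B : RepDouble β} {g : G} {u : A.V} (hu : A.Homog g u) (v : B.V) :
    braidLin A B (u ⊗ₜ[k] v) = B.φ g v ⊗ₜ[k] u := by
  classical
  simp only [braidLin, R, map_sum, LinearMap.comp_apply, LinearMap.sum_apply, actTwo_tmul,
    TensorProduct.map_tmul, homog_proj_eq hu]
  rw [Finset.sum_eq_single g]
  · simp [φ]
  · simp +contextual
  · simp

/-- The braiding as a homomorphism of modules. -/
noncomputable def braidHom (A B : RepDouble β) : tensor A B ⟶ tensor B A :=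
  mkHom (A := tensor A B) (B := tensor B A) (braidLin A B) (by
    intro a x v
    refine LinearMap.congr_fun (f := braidLin A B ∘ₗ (tensor A B).ρ (elt β a x))
      (g := (tensor B A).ρ (elt β a x) ∘ₗ braidLin A B) ?_ v
    refine lin_ext₂ fun g u h v hu hv => ?_
    refine comm_of_homog (A := tensor A B) (B := tensor B A) (braidLin A B) (hu.tensor hv) ?_ ?_ a x
    · rw [braidLin_homog hu]
      have := (homog_φ hv g).tensor hu
      simpa using this
    · intro x
      rw [braidLin_homog hu, tensor_φ hu hv, tensor_φ (homog_φ hv g) hu, map_smul,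
        braidLin_homog (homog_φ hu x), φ_φ hv, φ_φ hv]
      have e : x * g * x⁻¹ * x = x * g := by simp
      have := congrArg Units.val (β.γ_braid x g h)
      simp only [Units.val_mul] at this
      rw [e, ← TensorProduct.smul_tmul', ← TensorProduct.smul_tmul', smul_smul, smul_smul, this])

/-- The inverse of the braiding. -/
noncomputable def braidInvLin (A B : RepDouble β) : B.V ⊗[k] A.V →ₗ[k] A.V ⊗[k] B.V :=
  actTwo A B (∑ g : G, elt β g 1 ⊗ₜ[k] (∑ h : G, ((β.θ h g⁻¹ g)⁻¹ : kˣ).val • elt β h g⁻¹)) ∘ₗ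
    (TensorProduct.comm k B.V A.V).toLinearMap

theorem braidInvLin_homog {A B : RepDouble β} {g m : G} {u : A.V} {w : B.V} (hu : A.Homog g u)
    (hw : B.Homog m w) : braidInvLin A B (w ⊗ₜ[k] u) =
      ((β.θ (g⁻¹ * m * g) g⁻¹ g)⁻¹ : kˣ).val • (u ⊗ₜ[k] B.φ g⁻¹ w) := by
  classical
  simp only [braidInvLin, map_sum, LinearMap.comp_apply, LinearMap.sum_apply, actTwo_tmul,
    TensorProduct.map_tmul, homog_proj_eq hu, LinearEquiv.coe_coe, TensorProduct.comm_tmul,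
    map_smul, LinearMap.smul_apply, ρ_homog hw]
  rw [Finset.sum_eq_single g]
  · rw [if_pos rfl, Finset.sum_eq_single (g⁻¹ * m * g)]
    · simp
    · intro h _ hh
      rw [if_neg (by simpa using hh), smul_zero]
    · simp
  · simp +contextual
  · simp

/-- The braiding. -/
noncomputable def braid (A B : RepDouble β) : tensor A B ≅ tensor B A :=
  mkIso (braidHom A B) (braidInvLin A B)
    (by
      refine lin_ext₂ fun g u h v hu hv => ?_
      change braidInvLin A B (braidLin A B _) = _
      rw [braidLin_homog hu, braidInvLin_homog hu (homog_φ hv g), φ_φ hv, inv_mul_cancel, φ_one]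
      simp [mul_assoc])
    (by
      refine lin_ext₂ fun h v g u hv hu => ?_
      change braidLin A B (braidInvLin A B _) = _
      rw [braidInvLin_homog hu hv, map_smul, braidLin_homog hu, φ_φ hv, mul_inv_cancel, φ_one]
      have : β.θ (g⁻¹ * h * g) g⁻¹ g = β.θ h g g⁻¹ := by
        have := β.θ_cocycle h g g⁻¹ g
        simpa using this.symm
      rw [this]
      simp [← TensorProduct.smul_tmul', smul_smul])

theorem braid_naturality {A A' B B' : RepDouble β} (f : A ⟶ A') (g : B ⟶ B') :
    tensorHom f g ≫ (braid A' B').hom = (braid A B).hom ≫ tensorHom g f := hom_ext (by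
  refine lin_ext₂ fun a u b v hu hv => ?_
  change braidLin A' B' (f.lin u ⊗ₜ g.lin v) = TensorProduct.map g.lin f.lin (braidLin A B _)
  rw [braidLin_homog hu, braidLin_homog (hu.map f), TensorProduct.map_tmul, hom_φ])

/-- The modules over `D^β(k[G])` form a braided monoidal category. -/
noncomputable instance : BraidedCategory (RepDouble β) where
  braiding := braid
  braiding_naturality_right A _ _ f := braid_naturality (𝟙 A) f
  braiding_naturality_left f B := braid_naturality f (𝟙 B)
  hexagon_forward A B C := hom_ext (by
    refine lin_ext₃ fun a u b v c w hu hv hw => ?_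
    change assocLin B C A (braidLin A (tensor B C) (assocLin A B C ((u ⊗ₜ v) ⊗ₜ w))) =
      TensorProduct.map LinearMap.id (braidLin A C) (assocLin B A C
        (TensorProduct.map (braidLin A B) LinearMap.id ((u ⊗ₜ v) ⊗ₜ w)))
    rw [assocLin_homog hu hv hw, map_smul, braidLin_homog hu, tensor_φ hv hw,
      ← TensorProduct.smul_tmul', map_smul, map_smul,
      assocLin_homog (homog_φ hv a) (homog_φ hw a) hu, TensorProduct.map_tmul, braidLin_homog hu,
      LinearMap.id_apply, assocLin_homog (homog_φ hv a) hu hw, map_smul, TensorProduct.map_tmul,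
      braidLin_homog hu, LinearMap.id_apply, smul_smul, smul_smul, ← Units.val_mul,
      ← Units.val_mul]
    have := β.θ_hexagon a b c
    congr 2
    rw [eq_comm, inv_eq_iff_mul_eq_one]
    rw [← eq_mul_inv_iff_mul_eq] at this
    rw [this]
    apply Additive.ofMul.injective
    simp only [ofMul_mul, ofMul_inv, ofMul_one]
    abel)
  hexagon_reverse A B C := hom_ext (by
    refine lin_ext₃' fun a u b v c w hu hv hw => ?_
    change assocInvLin C A B (braidLin (tensor A B) C (assocInvLin A B C (u ⊗ₜ (v ⊗ₜ w)))) =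
      TensorProduct.map (braidLin A C) LinearMap.id (assocInvLin A C B
        (TensorProduct.map LinearMap.id (braidLin B C) (u ⊗ₜ (v ⊗ₜ w))))
    rw [assocInvLin_homog hu hv hw, map_smul, braidLin_homog (hu.tensor hv), map_smul,
      assocInvLin_homog (homog_φ hw (a * b)) hu hv, TensorProduct.map_tmul, braidLin_homog hv,
      LinearMap.id_apply, assocInvLin_homog hu (homog_φ hw b) hv, map_smul, TensorProduct.map_tmul,
      braidLin_homog hu, LinearMap.id_apply, φ_φ hw, ← TensorProduct.smul_tmul',
      ← TensorProduct.smul_tmul', smul_smul, smul_smul, ← Units.val_mul,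
      ← Units.val_mul]
    have := β.θ_hexagon' a b c
    congr 2
    rw [mul_comm, ← this, mul_comm])

end RepDouble

/-- A finite-dimensional `α`-twisted representation of the subgroup `H`: a map `ρ : H → GL(V)` with
`ρ(x) ρ(y) = α(x,y) ρ(xy)`. -/
structure TwistedRep (H : Subgroup G) (α : G → G → kˣ) where
  V : Type u
  [addCommGroup : AddCommGroup V]
  [module : Module k V]
  [finiteDimensional : FiniteDimensional k V]
  ρ : H → Module.End k V
  isUnit_ρ : ∀ x, IsUnit (ρ x)
  ρ_mul : ∀ x y, ρ x * ρ y = (α x y : k) • ρ (x * y)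

/-- `0 → U → V → W → 0` is exact. -/
def ShortExactLin {U V W : Type u} [AddCommGroup U] [AddCommGroup V] [AddCommGroup W]
    [Module k U] [Module k V] [Module k W] (f : U →ₗ[k] V) (g : V →ₗ[k] W) : Prop :=
  Function.Injective f ∧ Function.Exact f g ∧ Function.Surjective g

namespace TwistedRep
attribute [instance] addCommGroup module finiteDimensional
variable {H K : Subgroup G} {α : G → G → kˣ}

/-- An intertwiner of twisted representations. -/
@[ext]
structure Hom (A B : TwistedRep H α) where
  lin : A.V →ₗ[k] B.V
  comm : ∀ x v, lin (A.ρ x v) = B.ρ x (lin v)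

instance : Category (TwistedRep H α) where
  Hom := Hom
  id A := ⟨LinearMap.id, fun _ _ => rfl⟩
  comp f g := ⟨g.lin ∘ₗ f.lin, fun a v => by simp [f.comm, g.comm]⟩

@[ext]

theorem hom_ext {A B : TwistedRep H α} {f g : A ⟶ B} (h : f.lin = g.lin) : f = g := Hom.ext h

@[simp] theorem id_lin (A : TwistedRep H α) : Hom.lin (𝟙 A) = LinearMap.id := rfl

@[simp] theorem comp_lin {A B C : TwistedRep H α} (f : A ⟶ B) (g : B ⟶ C) :
    (f ≫ g).lin = g.lin ∘ₗ f.lin := rfl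

theorem isUnit_of_one {V : Type u} [AddCommGroup V] [Module k V] (ρ : H → Module.End k V)
    (h1 : ρ 1 = 1) (hm : ∀ x y, ρ x * ρ y = (α x y : k) • ρ (x * y)) (x : H) : IsUnit (ρ x) := by
  rw [isUnit_iff_exists_and_exists]
  refine ⟨⟨((α x (x⁻¹ : H) : kˣ)⁻¹ : kˣ).val • ρ x⁻¹, ?_⟩,
    ⟨((α (x⁻¹ : H) x : kˣ)⁻¹ : kˣ).val • ρ x⁻¹, ?_⟩⟩
  · rw [mul_smul_comm, hm, smul_smul, mul_inv_cancel, h1, Units.inv_mul, one_smul]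
  · rw [smul_mul_assoc, hm, smul_smul, inv_mul_cancel, h1, Units.inv_mul, one_smul]

/-- Restriction to a subgroup. -/
def res (hHK : H ≤ K) (A : TwistedRep K α) : TwistedRep H α where
  V := A.V
  ρ x := A.ρ (Subgroup.inclusion hHK x)
  isUnit_ρ x := A.isUnit_ρ _
  ρ_mul x y := A.ρ_mul _ _

def resMap (hHK : H ≤ K) {A B : TwistedRep K α} (f : A ⟶ B) : res hHK A ⟶ res hHK B where
  lin := f.lin
  comm x v := f.comm _ v

/-- The trivial one-dimensional representation. -/
def trivial (h : ∀ x y : H, α x y = 1) : TwistedRep H α where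
  V := k
  ρ _ := 1
  isUnit_ρ _ := isUnit_one
  ρ_mul x y := by simp [h]

/-- The zero representation. -/
def zero : TwistedRep H α where
  V := PUnit
  ρ _ := 1
  isUnit_ρ _ := isUnit_one
  ρ_mul x y := Subsingleton.elim _ _

/-- The direct sum of finitely many twisted representations. -/
def pi {ι : Type u} [Finite ι] (A : ι → TwistedRep H α) : TwistedRep H α where
  V := ∀ i, (A i).V
  ρ x := LinearMap.pi fun i => (A i).ρ x ∘ₗ LinearMap.proj i
  isUnit_ρ x := by
    rw [Module.End.isUnit_iff]
    have h i := (Module.End.isUnit_iff _).1 ((A i).isUnit_ρ x)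
    constructor
    · intro v w e
      funext i
      exact (h i).1 (congrFun e i)
    · intro w
      choose v hv using fun i => (h i).2 (w i)
      exact ⟨v, funext hv⟩
  ρ_mul x y := by
    ext v i
    exact LinearMap.congr_fun ((A i).ρ_mul x y) (v i)

def piMap {ι : Type u} [Finite ι] {A B : ι → TwistedRep H α} (f : ∀ i, A i ⟶ B i) :
    pi A ⟶ pi B where
  lin := LinearMap.pi fun i => (f i).lin ∘ₗ LinearMap.proj i
  comm x v := funext fun i => (f i).comm x (v i)

/-- `α` is a (right normalized) 2-cocycle on the subgroup `K`. -/
structure IsCocycleOn (K : Subgroup G) (α : G → G → kˣ) : Prop where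
  cocycle : ∀ x y z : K, α x y * α (x * y) z = α x (y * z) * α y z
  one_right : ∀ x : K, α x 1 = 1

/-- The functions `f : K → V` with `ρ(h) f(x) = α(h,x) f(hx)` for `h ∈ H`, `x ∈ K`. -/
def indSubmodule (hHK : H ≤ K) (A : TwistedRep H α) : Submodule k (K → A.V) where
  carrier := {f | ∀ (h : H) (x : K), A.ρ h (f x) = (α h x : k) • f (Subgroup.inclusion hHK h * x)}
  add_mem' hf hg h x := by simp [hf h x, hg h x]
  zero_mem' h x := by simp
  smul_mem' c f hf h x := by simp [hf h x, smul_comm c]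

theorem indAux (hHK : H ≤ K) (hα : IsCocycleOn K α) (A : TwistedRep H α) (y : K) (f : K → A.V)
    (hf : f ∈ indSubmodule hHK A) :
    (fun x : K => (α x y : k) • f (x * y)) ∈ indSubmodule hHK A := by
  intro h x
  have := congrArg Units.val (hα.cocycle (Subgroup.inclusion hHK h) x y)
  simp only [Units.val_mul, Subgroup.coe_inclusion] at this
  simp only [map_smul, hf h (x * y), smul_smul, mul_assoc, Subgroup.coe_mul,
    Subgroup.coe_inclusion]
  rw [this, mul_comm]

/-- The action `(y f)(x) = α(x,y) f(xy)` of `K`. -/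
def indAct (hHK : H ≤ K) (hα : IsCocycleOn K α) (A : TwistedRep H α) (y : K) :
    Module.End k (indSubmodule hHK A) where
  toFun f := ⟨fun x => (α x y : k) • f.1 (x * y), indAux hHK hα A y f.1 f.2⟩
  map_add' f g := by ext x; simp
  map_smul' c f := by ext x; simp [smul_comm c]

theorem indAct_mul (hHK : H ≤ K) (hα : IsCocycleOn K α) (A : TwistedRep H α) (y z : K) :
    indAct hHK hα A y * indAct hHK hα A z = (α y z : k) • indAct hHK hα A (y * z) := by
  ext f x
  have := congrArg Units.val (hα.cocycle x y z)
  simp only [Units.val_mul] at this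
  change (α x y : k) • (α (x * y : K) z : k) • f.1 (x * y * z) =
    (α y z : k) • (α x (y * z : K) : k) • f.1 (x * (y * z))
  rw [smul_smul, smul_smul, mul_assoc, Subgroup.coe_mul, Subgroup.coe_mul, this, mul_comm]

/-- The `α`-twisted representation of `K` induced from `H`, realized on equivariant functions
(for finite groups this is the tensor product with the twisted group algebra of `K`). -/
def ind (hHK : H ≤ K) (hα : IsCocycleOn K α) [Finite K] (A : TwistedRep H α) :
    TwistedRep K α where
  V := indSubmodule hHK A
  ρ := indAct hHK hα A
  isUnit_ρ := isUnit_of_one _ (by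
    ext f x
    have := hα.one_right x
    simp [indAct, this]) (indAct_mul hHK hα A)
  ρ_mul := indAct_mul hHK hα A

def indMap (hHK : H ≤ K) (hα : IsCocycleOn K α) [Finite K] {A B : TwistedRep H α} (f : A ⟶ B) :
    ind hHK hα A ⟶ ind hHK hα B where
  lin :=
    { toFun := fun s => ⟨fun x => f.lin (s.1 x), fun h x => by
        rw [← f.comm, s.2 h x, map_smul]⟩
      map_add' := fun s t => Subtype.ext (funext fun x => f.lin.map_add _ _)
      map_smul' := fun c s => Subtype.ext (funext fun x => f.lin.map_smul _ _) }
  comm y s := Subtype.ext (funext fun x => f.lin.map_smul _ _)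

theorem indMap_exact (hHK : H ≤ K) (hα : IsCocycleOn K α) [Finite K] {A B C : TwistedRep H α}
    (f : A ⟶ B) (g : B ⟶ C) (h : ShortExactLin f.lin g.lin) :
    ShortExactLin (indMap hHK hα f).lin (indMap hHK hα g).lin := by
  obtain ⟨hi, he, hs⟩ := h
  refine ⟨fun s t e => Subtype.ext (funext fun x => hi (congrFun (congrArg Subtype.val e) x)),
    fun s => ⟨fun e => ?_, ?_⟩, fun s => ?_⟩
  · have h1 : ∀ x, ∃ v, f.lin v = s.1 x := fun x =>
      (he _).1 (congrFun (congrArg Subtype.val e) x)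
    choose t ht using h1
    refine ⟨⟨t, fun h x => hi ?_⟩, Subtype.ext (funext ht)⟩
    rw [f.comm, ht, s.2 h x, map_smul, ht]
  · rintro ⟨t, rfl⟩
    exact Subtype.ext (funext fun x => (he _).2 ⟨_, rfl⟩)
  · let r : K → K := fun x => (Quotient.out (s := QuotientGroup.rightRel (H.subgroupOf K))
      (Quotient.mk _ x))
    have hr : ∀ x, ∃ h : H, x = Subgroup.inclusion hHK h * r x := by
      intro x
      have h1 : (QuotientGroup.rightRel (H.subgroupOf K)).r (r x) x := Quotient.mk_out x
      rw [QuotientGroup.rightRel_apply] at h1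
      exact ⟨⟨_, h1⟩, by ext; simp⟩
    have hr' : ∀ (h : H) x, r (Subgroup.inclusion hHK h * x) = r x := by
      intro h x
      have : (Quotient.mk (QuotientGroup.rightRel (H.subgroupOf K)) (Subgroup.inclusion hHK h * x))
          = Quotient.mk _ x := by
        apply Quotient.sound
        change (QuotientGroup.rightRel (H.subgroupOf K)).r _ _
        rw [QuotientGroup.rightRel_apply]
        simp [Subgroup.mem_subgroupOf]
      simp only [r, this]
    choose η hη using hr
    have hη' : ∀ (h : H) x, η (Subgroup.inclusion hHK h * x) = h * η x := by
      intro h x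
      have h1 := hη (Subgroup.inclusion hHK h * x)
      rw [hr'] at h1
      conv_lhs at h1 => rw [hη x]
      rw [← mul_assoc, mul_left_inj, ← map_mul] at h1
      exact (Subgroup.inclusion_injective hHK h1).symm
    choose σ hσ using hs
    refine ⟨⟨fun x => ((α (η x) (r x))⁻¹ : kˣ).val • B.ρ (η x) (σ (s.1 (r x))), ?_⟩, ?_⟩
    · intro h x
      have hc := hα.cocycle (Subgroup.inclusion hHK h) (Subgroup.inclusion hHK (η x)) (r x)
      simp only [hη', hr']
      have hm := LinearMap.congr_fun (B.ρ_mul h (η x)) (σ (s.1 (r x)))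
      change B.ρ h (B.ρ (η x) _) = (α h (η x) : k) • B.ρ (h * η x) _ at hm
      rw [map_smul, hm, smul_smul, smul_smul, ← Units.val_mul, ← Units.val_mul]
      congr 2
      have hx : (x : G) = η x * r x := congrArg Subtype.val (hη x)
      simp only [Subgroup.coe_inclusion, Subgroup.coe_mul] at hc
      rw [← hx] at hc
      have hc' := congrArg Additive.ofMul hc
      apply Additive.ofMul.injective
      simp only [ofMul_mul, ofMul_inv, Subgroup.coe_mul, Subgroup.coe_inclusion] at hc' ⊢
      linear_combination (norm := abel) hc'
    · refine Subtype.ext (funext fun x => ?_)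
      change g.lin (((α (η x) (r x))⁻¹ : kˣ).val • B.ρ (η x) (σ (s.1 (r x)))) = s.1 x
      rw [map_smul, g.comm, hσ, s.2, ← hη x, smul_smul]
      simp

theorem piMap_exact {ι : Type u} [Finite ι] {A B C : ι → TwistedRep H α} (f : ∀ i, A i ⟶ B i)
    (g : ∀ i, B i ⟶ C i) (h : ∀ i, ShortExactLin (f i).lin (g i).lin) :
    ShortExactLin (piMap f).lin (piMap g).lin := by
  refine ⟨fun s t e => funext fun i => (h i).1 (congrFun e i), fun s => ⟨fun e => ?_, ?_⟩,
    fun s => ?_⟩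
  · choose t ht using fun i => ((h i).2.1 (s i)).1 (congrFun e i)
    exact ⟨t, funext ht⟩
  · rintro ⟨t, rfl⟩
    exact funext fun i => ((h i).2.1 _).2 ⟨_, rfl⟩
  · choose t ht using fun i => (h i).2.2 (s i)
    exact ⟨t, funext ht⟩

end TwistedRep

theorem ShortExactLin.map_id {U V W X : Type u} [AddCommGroup U] [AddCommGroup V] [AddCommGroup W]
    [AddCommGroup X] [Module k U] [Module k V] [Module k W] [Module k X] {f : U →ₗ[k] V}
    {g : V →ₗ[k] W} (h : ShortExactLin f g) :
    ShortExactLin (TensorProduct.map f (LinearMap.id : X →ₗ[k] X)) (TensorProduct.map g LinearMap.id) :=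
  ⟨Module.Flat.rTensor_preserves_injective_linearMap (M := X) f h.1,
    Module.Flat.rTensor_exact X h.2.1, LinearMap.rTensor_surjective X h.2.2⟩

theorem ShortExactLin.id_map {U V W X : Type u} [AddCommGroup U] [AddCommGroup V] [AddCommGroup W]
    [AddCommGroup X] [Module k U] [Module k V] [Module k W] [Module k X] {f : U →ₗ[k] V}
    {g : V →ₗ[k] W} (h : ShortExactLin f g) :
    ShortExactLin (TensorProduct.map (LinearMap.id : X →ₗ[k] X) f) (TensorProduct.map LinearMap.id g) :=
  ⟨Module.Flat.lTensor_preserves_injective_linearMap (M := X) f h.1,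
    Module.Flat.lTensor_exact X h.2.1, LinearMap.lTensor_surjective X h.2.2⟩

namespace NormalizedCocycle
variable (β : NormalizedCocycle G k)

theorem mem_conj {g x z m : G} (hm : m = x * g * x⁻¹)
    (hz : z ∈ Subgroup.centralizer {m}) : x⁻¹ * z * x ∈ Subgroup.centralizer {g} := by
  rw [Subgroup.mem_centralizer_singleton_iff] at hz ⊢
  subst hm
  have := congrArg (fun t => x⁻¹ * t * x) hz
  simpa [mul_assoc] using this

theorem conj_of_mem {g z : G} (hz : z ∈ Subgroup.centralizer {g}) : z⁻¹ * g * z = g := by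
  rw [Subgroup.mem_centralizer_singleton_iff] at hz
  rw [mul_assoc, ← hz, inv_mul_cancel_left]

theorem θ_isCocycleOn (g : G) : TwistedRep.IsCocycleOn (Subgroup.centralizer {g}) (β.θ g) where
  cocycle x y z := by
    have := β.θ_cocycle g x y z
    rwa [conj_of_mem x.2] at this
  one_right x := β.θ_one_right g x

theorem conj_scalar {g x z w m : G} (hm : m = x * g * x⁻¹)
    (hz : z ∈ Subgroup.centralizer {m}) (hw : w ∈ Subgroup.centralizer {m}) :
    (β.θ m z x / β.θ m x (x⁻¹ * z * x)) * (β.θ m w x / β.θ m x (x⁻¹ * w * x)) *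
      β.θ g (x⁻¹ * z * x) (x⁻¹ * w * x) =
    β.θ m z w * (β.θ m (z * w) x / β.θ m x (x⁻¹ * (z * w) * x)) := by
  have h1 := β.θ_cocycle m z w x
  have h2 := β.θ_cocycle m x (x⁻¹ * z * x) (x⁻¹ * w * x)
  have h3 := β.θ_cocycle m z x (x⁻¹ * w * x)
  rw [conj_of_mem hz] at h1 h3
  have hg : x⁻¹ * m * x = g := by subst hm; simp [mul_assoc]
  rw [hg] at h2
  have h1 := congrArg Additive.ofMul h1
  have h2 := congrArg Additive.ofMul h2
  have h3 := congrArg Additive.ofMul h3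
  apply Additive.ofMul.injective
  simp only [ofMul_mul, ofMul_div, mul_assoc, mul_inv_cancel_left] at h1 h2 h3 ⊢
  linear_combination (norm := abel) h3 - h1 - h2

end NormalizedCocycle

open NormalizedCocycle in
/-- Pullback along the isomorphism `z ↦ x⁻¹zx` of centralizers `Z(m) → Z(g)`, `m = xgx⁻¹`: this
is the canonical isomorphism of stacks between `[{m}/Z(m)]` and `[{g}/Z(g)]`, together with the
isomorphism of the twists `θ_g` and `θ_m` that `θ` provides. -/
noncomputable def TwistedRep.conj (β : NormalizedCocycle G k) {g m : G} (x : G)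
    (hm : m = x * g * x⁻¹) (A : TwistedRep (Subgroup.centralizer {g}) (β.θ g)) :
    TwistedRep (Subgroup.centralizer {m}) (β.θ m) where
  V := A.V
  ρ z := (β.θ m z x / β.θ m x (x⁻¹ * z * x) : kˣ).val • A.ρ ⟨x⁻¹ * z * x, mem_conj hm z.2⟩
  isUnit_ρ z := (A.isUnit_ρ _).smul (β.θ m z x / β.θ m x (x⁻¹ * z * x))
  ρ_mul z w := by
    rw [smul_mul_smul_comm, A.ρ_mul, smul_smul, smul_smul, ← Units.val_mul, ← Units.val_mul,
      ← Units.val_mul, β.conj_scalar hm z.2 w.2]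
    refine congrArg _ (congrArg A.ρ (Subtype.ext ?_))
    simp [mul_assoc]

noncomputable def TwistedRep.conjMap (β : NormalizedCocycle G k) {g m : G} (x : G)
    (hm : m = x * g * x⁻¹) {A B : TwistedRep (Subgroup.centralizer {g}) (β.θ g)} (f : A ⟶ B) :
    A.conj β x hm ⟶ B.conj β x hm where
  lin := f.lin
  comm z v := (f.lin.map_smul _ _).trans (congrArg _ (f.comm _ v))

theorem conj_of_mem_pair {a b z : G} (hz : z ∈ Subgroup.centralizer {a, b}) :
    z⁻¹ * a * z = a ∧ z⁻¹ * b * z = b := by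
  rw [Subgroup.mem_centralizer_iff] at hz
  constructor
  · rw [mul_assoc, hz a (by simp), inv_mul_cancel_left]
  · rw [mul_assoc, hz b (by simp), inv_mul_cancel_left]

/-- The twisted tensor product: for `x ∈ Z(a,b)` the action is `γ_x(a,b) ρ(x) ⊗ ρ'(x)`. -/
noncomputable def TwistedRep.tensor (β : NormalizedCocycle G k) {a b m : G} (hm : a * b = m)
    (A : TwistedRep (Subgroup.centralizer {a, b}) (β.θ a))
    (B : TwistedRep (Subgroup.centralizer {a, b}) (β.θ b)) :
    TwistedRep (Subgroup.centralizer {a, b}) (β.θ m) where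
  V := A.V ⊗[k] B.V
  ρ x := (β.γ x a b : k) • TensorProduct.map (A.ρ x) (B.ρ x)
  isUnit_ρ x := by
    refine IsUnit.smul (β.γ x a b) ?_
    rw [Module.End.isUnit_iff]
    exact TensorProduct.map_bijective ((Module.End.isUnit_iff _).1 (A.isUnit_ρ x))
      ((Module.End.isUnit_iff _).1 (B.isUnit_ρ x))
  ρ_mul x y := by
    subst hm
    obtain ⟨h1, h2⟩ := conj_of_mem_pair x.2
    have := β.γ_θ a b x y
    rw [h1, h2] at this
    have := congrArg Units.val this
    simp only [Units.val_mul] at this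
    rw [smul_mul_smul_comm, ← TensorProduct.map_mul, A.ρ_mul, B.ρ_mul, TensorProduct.map_smul_left,
      TensorProduct.map_smul_right, smul_smul, smul_smul, smul_smul, Subgroup.coe_mul, ← this,
      mul_assoc, mul_assoc]

noncomputable def TwistedRep.tensorMap (β : NormalizedCocycle G k) {a b m : G} (hm : a * b = m)
    {A A' : TwistedRep (Subgroup.centralizer {a, b}) (β.θ a)}
    {B B' : TwistedRep (Subgroup.centralizer {a, b}) (β.θ b)} (f : A ⟶ A') (g : B ⟶ B') :
    A.tensor β hm B ⟶ A'.tensor β hm B' where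
  lin := TensorProduct.map f.lin g.lin
  comm x v := by
    refine LinearMap.congr_fun (f := TensorProduct.map f.lin g.lin ∘ₗ (A.tensor β hm B).ρ x)
      (g := (A'.tensor β hm B').ρ x ∘ₗ TensorProduct.map f.lin g.lin) ?_ v
    apply TensorProduct.ext'
    intro v w
    change TensorProduct.map f.lin g.lin ((β.γ x a b : k) • (A.ρ x v ⊗ₜ[k] B.ρ x w)) =
      (β.γ x a b : k) • (A'.ρ x (f.lin v) ⊗ₜ[k] B'.ρ x (g.lin w))
    rw [map_smul, TensorProduct.map_tmul, f.comm, g.comm]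

/-- A chosen representative of a conjugacy class. -/
noncomputable def classRep (c : ConjClasses G) : G := Quotient.out (s := IsConj.setoid G) c

theorem mk_classRep (c : ConjClasses G) : ConjClasses.mk (classRep c) = c :=
  Quotient.out_eq (s := IsConj.setoid G) c

theorem exists_conjugator (m : G) : ∃ x, m = x * classRep (ConjClasses.mk m) * x⁻¹ := by
  have := ConjClasses.mk_eq_mk_iff_isConj.1 (mk_classRep (ConjClasses.mk m))
  obtain ⟨x, hx⟩ := isConj_iff.1 this
  exact ⟨x, hx.symm⟩

/-- A chosen element that conjugates the representative of the class of `m` to `m`. -/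
noncomputable def conjugator (m : G) : G := Classical.choose (exists_conjugator m)

theorem conjugator_spec (m : G) : m = conjugator m * classRep (ConjClasses.mk m) * (conjugator m)⁻¹ :=
  Classical.choose_spec (exists_conjugator m)

/-- A `β`-twisted vector bundle on the inertia stack `I[pt/G] = ∐_{[g]} [pt/Z(g)]` of `[pt/G]`: for
each conjugacy class `[g]` a finite-dimensional `θ_g`-twisted representation of `Z(g)`. -/
abbrev InertiaBundle (β : NormalizedCocycle G k) : Type (u + 1) :=
  ∀ c : ConjClasses G, TwistedRep (Subgroup.centralizer {classRep c}) (β.θ (classRep c))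

/-- Simultaneous conjugacy of pairs `(m₁, m₂)` with `m₁m₂ = h`. An element that conjugates one such
pair to another centralizes `h`. -/
def pairSetoid (h : G) : Setoid {p : G × G // p.1 * p.2 = h} where
  r p q := ∃ z : G, z * p.1.1 * z⁻¹ = q.1.1 ∧ z * p.1.2 * z⁻¹ = q.1.2
  iseqv :=
    { refl := fun p => ⟨1, by simp, by simp⟩
      symm := by
        rintro p q ⟨z, h1, h2⟩
        exact ⟨z⁻¹, by simp [← h1, mul_assoc], by simp [← h2, mul_assoc]⟩
      trans := by
        rintro p q r ⟨z, h1, h2⟩ ⟨w, h3, h4⟩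
        exact ⟨w * z, by simp [← h3, ← h1, mul_assoc], by simp [← h4, ← h2, mul_assoc]⟩ }

/-- The components `[m₁, m₂]` of the double inertia stack that lie over the component of `h` under
multiplication. -/
abbrev Sector (h : G) : Type u := Quotient (pairSetoid h)

/-- The first entry `m₁` of a chosen representative. -/
noncomputable def Sector.fst {h : G} (s : Sector h) : G := (Quotient.out s).1.1

/-- The second entry `m₂` of a chosen representative. -/
noncomputable def Sector.snd {h : G} (s : Sector h) : G := (Quotient.out s).1.2

theorem Sector.mul {h : G} (s : Sector h) : s.fst * s.snd = h := (Quotient.out s).2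

theorem centralizer_pair_le_left (a b : G) :
    Subgroup.centralizer {a, b} ≤ Subgroup.centralizer {a} :=
  Subgroup.centralizer_le (by simp)

theorem centralizer_pair_le_right (a b : G) :
    Subgroup.centralizer {a, b} ≤ Subgroup.centralizer {b} :=
  Subgroup.centralizer_le (by simp)

theorem centralizer_pair_le_mul {a b m : G} (h : a * b = m) :
    Subgroup.centralizer {a, b} ≤ Subgroup.centralizer {m} := by
  intro z hz
  rw [Subgroup.mem_centralizer_iff] at hz
  rw [Subgroup.mem_centralizer_singleton_iff]
  have h1 := hz a (by simp)
  have h2 := hz b (by simp)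
  rw [← h, ← mul_assoc, ← h1, mul_assoc, mul_assoc, h2]

namespace InertiaBundle
open TwistedRep
variable {β : NormalizedCocycle G k}

/-- The restriction `F_m` of the bundle to the sector of `m`, a `θ_m`-twisted representation of
`Z(m)`. -/
noncomputable def atElt (F : InertiaBundle β) (m : G) :
    TwistedRep (Subgroup.centralizer {m}) (β.θ m) :=
  (F (ConjClasses.mk m)).conj β (conjugator m) (conjugator_spec m)

noncomputable def atEltMap {F F' : InertiaBundle β} (f : F ⟶ F') (m : G) :
    F.atElt m ⟶ F'.atElt m :=
  conjMap β (conjugator m) (conjugator_spec m) (f (ConjClasses.mk m))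

/-- `e₁^*(F) ⊗^γ e₂^*(F')` on the component `[pt/Z(m₁,m₂)]` of the double inertia stack. -/
noncomputable def sectorTensor (F F' : InertiaBundle β) {h : G} (s : Sector h) :
    TwistedRep (Subgroup.centralizer {s.fst, s.snd}) (β.θ h) :=
  TwistedRep.tensor β s.mul (res (centralizer_pair_le_left _ _) (F.atElt s.fst))
    (res (centralizer_pair_le_right _ _) (F'.atElt s.snd))

noncomputable def sectorTensorMap {F₁ F₂ F₁' F₂' : InertiaBundle β} (f : F₁ ⟶ F₂) (f' : F₁' ⟶ F₂')
    {h : G} (s : Sector h) : F₁.sectorTensor F₁' s ⟶ F₂.sectorTensor F₂' s :=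
  tensorMap β s.mul (resMap _ (atEltMap f s.fst)) (resMap _ (atEltMap f' s.snd))

variable [Finite G]

/-- The push-pull product `e₃_*(e₁^*(F) ⊗^γ e₂^*(F'))`. Over the class of `h` it is the sum over the
classes of pairs with `m₁m₂ = h` of the representations induced from `Z(m₁,m₂)` to `Z(h)`; over a
point the obstruction bundle is trivial. -/
noncomputable def mul (F F' : InertiaBundle β) : InertiaBundle β := fun c =>
  TwistedRep.pi fun s : Sector (classRep c) =>
    ind (centralizer_pair_le_mul s.mul) (β.θ_isCocycleOn (classRep c)) (F.sectorTensor F' s)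

/-- The push-pull product on morphisms. -/
noncomputable def mulMap {F₁ F₂ F₁' F₂' : InertiaBundle β} (f : F₁ ⟶ F₂) (f' : F₁' ⟶ F₂') :
    F₁.mul F₁' ⟶ F₂.mul F₂' := fun c =>
  piMap fun s : Sector (classRep c) =>
    indMap (centralizer_pair_le_mul s.mul) (β.θ_isCocycleOn (classRep c)) (sectorTensorMap f f' s)

/-- The push-pull product as a functor of both variables. -/
noncomputable def pushPull (β : NormalizedCocycle G k) :
    InertiaBundle β × InertiaBundle β ⥤ InertiaBundle β where
  obj P := P.1.mul P.2
  map f := mulMap f.1 f.2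
  map_id P := by
    funext c
    apply TwistedRep.hom_ext
    refine LinearMap.ext fun v => funext fun s => Subtype.ext (funext fun x => ?_)
    exact LinearMap.congr_fun TensorProduct.map_id _
  map_comp f g := by
    funext c
    apply TwistedRep.hom_ext
    refine LinearMap.ext fun v => funext fun s => Subtype.ext (funext fun x => ?_)
    exact LinearMap.congr_fun (TensorProduct.map_comp _ _ _ _) _

open Classical in
/-- The unit: the trivial line bundle on the untwisted sector. -/
noncomputable def one (β : NormalizedCocycle G k) : InertiaBundle β := fun c =>
  if h : classRep c = 1 then
    TwistedRep.trivial (fun x y => (congrArg (fun g => β.θ g x y) h).trans (β.θ_one _ _))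
  else TwistedRep.zero

/-- Short exact sequences of bundles on the inertia stack. -/
def ShortExact (A B C : InertiaBundle β) : Prop :=
  ∃ (f : A ⟶ B) (g : B ⟶ C), ∀ c, ShortExactLin (f c).lin (g c).lin

theorem ShortExact.mul_left {A B C : InertiaBundle β} (F : InertiaBundle β)
    (h : ShortExact A B C) : ShortExact (F.mul A) (F.mul B) (F.mul C) := by
  obtain ⟨f, g, h⟩ := h
  exact ⟨mulMap (𝟙 F) f, mulMap (𝟙 F) g, fun c => piMap_exact _ _ fun s =>
    indMap_exact _ _ _ _ (h (ConjClasses.mk s.snd)).id_map⟩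

theorem ShortExact.mul_right {A B C : InertiaBundle β} (F : InertiaBundle β)
    (h : ShortExact A B C) : ShortExact (A.mul F) (B.mul F) (C.mul F) := by
  obtain ⟨f, g, h⟩ := h
  exact ⟨mulMap f (𝟙 F), mulMap g (𝟙 F), fun c => piMap_exact _ _ fun s =>
    indMap_exact _ _ _ _ (h (ConjClasses.mk s.fst)).map_id⟩

end InertiaBundle

/-- Short exact sequences of modules. -/
def RepDouble.ShortExact [Fintype G] {β : NormalizedCocycle G k} (A B C : RepDouble β) : Prop :=
  ∃ (f : A ⟶ B) (g : B ⟶ C), ShortExactLin f.lin g.lin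

/-- The free abelian group on `X` modulo `[B] = [A] + [C]` for each sequence `r A B C`. -/
def GrothendieckGroup {X : Type (u + 1)} (r : X → X → X → Prop) : Type (u + 1) :=
  FreeAbelianGroup X ⧸ AddSubgroup.closure
    {x | ∃ A B C, r A B C ∧
      x = FreeAbelianGroup.of B - FreeAbelianGroup.of A - FreeAbelianGroup.of C}

namespace GrothendieckGroup
variable {X : Type (u + 1)} {r : X → X → X → Prop}

instance : AddCommGroup (GrothendieckGroup r) :=
  inferInstanceAs (AddCommGroup (FreeAbelianGroup X ⧸ _))

def mk (r : X → X → X → Prop) (A : X) : GrothendieckGroup r :=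
  QuotientAddGroup.mk (FreeAbelianGroup.of A)

theorem mk_eq {A B C : X} (h : r A B C) : mk r B = mk r A + mk r C := by
  have : (QuotientAddGroup.mk (FreeAbelianGroup.of B - FreeAbelianGroup.of A -
      FreeAbelianGroup.of C) : GrothendieckGroup r) = 0 := by
    refine (QuotientAddGroup.eq_zero_iff _).2 (AddSubgroup.subset_closure ⟨A, B, C, h, rfl⟩)
  change mk r B - mk r A - mk r C = 0 at this
  rw [sub_sub, sub_eq_zero] at this
  exact this

def lift {M : Type (u + 1)} [AddCommGroup M] (f : X → M)
    (h : ∀ A B C, r A B C → f B = f A + f C) : GrothendieckGroup r →+ M :=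
  QuotientAddGroup.lift _ (FreeAbelianGroup.lift f) (by
    rw [AddSubgroup.closure_le]
    rintro _ ⟨A, B, C, hr, rfl⟩
    simp [h A B C hr])

@[simp] theorem lift_mk {M : Type (u + 1)} [AddCommGroup M] (f : X → M)
    (h : ∀ A B C, r A B C → f B = f A + f C) (A : X) : lift f h (mk r A) = f A :=
  FreeAbelianGroup.lift_apply_of f A

theorem hom_ext {M : Type (u + 1)} [AddCommGroup M] {f g : GrothendieckGroup r →+ M}
    (h : ∀ A, f (mk r A) = g (mk r A)) : f = g := by
  refine QuotientAddGroup.addMonoidHom_ext _ (FreeAbelianGroup.lift.symm.injective ?_)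
  funext A
  exact h A

def lift₂ (op : X → X → X) (hl : ∀ F A B C, r A B C → r (op F A) (op F B) (op F C))
    (hr : ∀ F A B C, r A B C → r (op A F) (op B F) (op C F)) :
    GrothendieckGroup r →+ GrothendieckGroup r →+ GrothendieckGroup r :=
  lift (fun F => lift (fun A => mk r (op F A)) fun A B C h => mk_eq (hl F A B C h))
    fun A B C h => hom_ext fun F => by simpa using mk_eq (hr F A B C h)

theorem lift₂_mk (op : X → X → X) (hl : ∀ F A B C, r A B C → r (op F A) (op F B) (op F C))
    (hr : ∀ F A B C, r A B C → r (op A F) (op B F) (op C F)) (A B : X) :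
    lift₂ op hl hr (mk r A) (mk r B) = mk r (op A B) := by
  simp [lift₂]

end GrothendieckGroup

/-- The `β`-twisted full K-theory of `[pt/G]`: the Grothendieck group of `β`-twisted vector bundles
on the inertia stack, with the push-pull product. -/
def KFull [Finite G] (β : NormalizedCocycle G k) : Type (u + 1) :=
  GrothendieckGroup (InertiaBundle.ShortExact (β := β))

namespace KFull
variable [Finite G] (β : NormalizedCocycle G k)

instance : AddCommGroup (KFull β) := inferInstanceAs (AddCommGroup (GrothendieckGroup _))
variable {β} in
def mk (F : InertiaBundle β) : KFull β := GrothendieckGroup.mk _ F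

noncomputable def mulHom : KFull β →+ KFull β →+ KFull β :=
  GrothendieckGroup.lift₂ InertiaBundle.mul (fun F _ _ _ h => h.mul_left F)
    (fun F _ _ _ h => h.mul_right F)

noncomputable instance : NonUnitalNonAssocRing (KFull β) :=
  { (inferInstance : AddCommGroup (KFull β)) with
    mul := fun a b => mulHom β a b
    left_distrib := fun a b c => (mulHom β a).map_add b c
    right_distrib := fun a b c => by
      change mulHom β (a + b) c = mulHom β a c + mulHom β b c
      simp
    zero_mul := fun a => by change mulHom β 0 a = 0; simp
    mul_zero := fun a => by change mulHom β a 0 = 0; simp }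

noncomputable instance : One (KFull β) := ⟨mk (InertiaBundle.one β)⟩

theorem mk_mul (F F' : InertiaBundle β) : mk F * mk F' = mk (F.mul F') := by
  exact GrothendieckGroup.lift₂_mk _ _ _ _ _

end KFull

/-- The representation ring of `D^β(k[G])`: the Grothendieck group of finite-dimensional modules, with
the tensor product of modules as product. -/
def RepRing [Fintype G] (β : NormalizedCocycle G k) : Type (u + 1) :=
  GrothendieckGroup (RepDouble.ShortExact (β := β))

namespace RepRing
variable [Fintype G] (β : NormalizedCocycle G k)

instance : AddCommGroup (RepRing β) := inferInstanceAs (AddCommGroup (GrothendieckGroup _))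
variable {β} in
def mk (A : RepDouble β) : RepRing β := GrothendieckGroup.mk _ A

noncomputable def mulHom : RepRing β →+ RepRing β →+ RepRing β :=
  GrothendieckGroup.lift₂ (fun A B : RepDouble β => A ⊗ B)
    (by
      rintro F A B C ⟨f, g, h⟩
      exact ⟨F ◁ f, F ◁ g, h.id_map⟩)
    (by
      rintro F A B C ⟨f, g, h⟩
      exact ⟨f ▷ F, g ▷ F, h.map_id⟩)

noncomputable instance : NonUnitalNonAssocRing (RepRing β) :=
  { (inferInstance : AddCommGroup (RepRing β)) with
    mul := fun a b => mulHom β a b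
    left_distrib := fun a b c => (mulHom β a).map_add b c
    right_distrib := fun a b c => by
      change mulHom β (a + b) c = mulHom β a c + mulHom β b c
      simp
    zero_mul := fun a => by change mulHom β 0 a = 0; simp
    mul_zero := fun a => by change mulHom β a 0 = 0; simp }

noncomputable instance : One (RepRing β) := ⟨mk (𝟙_ (RepDouble β))⟩

theorem mk_mul (A B : RepDouble β) : mk A * mk B = mk (A ⊗ B) := by
  exact GrothendieckGroup.lift₂_mk _ _ _ _ _

end RepRing

end TwistedDoubleDefs

/-! ### Homogeneous parts of a module, and exactness tested on them -/

section HomogeneousParts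
variable {G k : Type u} [Group G] [Field k] [Fintype G] {β : NormalizedCocycle G k}

namespace RepDouble
open TwistedDouble

/-! A module M over the twisted double is a G-graded space: the idempotents g⌊1 are orthogonal with
sum 1 and cut out the parts M_g. The operators φ(x) map M_g to M_{xgx⁻¹} and compose up to the
scalars θ. Each φ(x) is bijective, so M is determined by one part M_g in each conjugacy class, with
its action of Z(g), which is a θ_g-twisted representation. This is `toBundle`.

The quasi-inverse `toDouble` induces F_c from Z(g) to G, where g represents c: its vectors are
functions f on G with ρ(h) f(x) = θ_g(h,x) f(hx) for h in Z(g), and the value at x contributes to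
degree x⁻¹gx. Degree g leaves only functions supported on Z(g), and evaluation at 1 recovers F_c
(`evalOne_bijective`). The other composite is handled by `toTotal_bijective`, because bijectivity of
a homomorphism can be tested in the representing degrees (`shortExactLin_of_toBundle`).

For the product, (M ⊗ N)_g is the sum of M_a ⊗ N_b over ab = g. The group Z(g) permutes these
summands by simultaneous conjugation, with the scalar γ that comes from Δ. A sum of permuted
summands is the sum over orbits of the representation induced from the stabilizer Z(a,b) of one
summand, and this is the push-pull formula (`toPushPull`, `tensorPushPullIso`).

The braided structure on bundles is transported along the equivalence, so that its coherence is
automatic; what needs proof is that the transported product and unit are the push-pull product and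
the trivial line bundle. Both functors are exact and therefore induce mutually inverse maps of
Grothendieck groups. The formulas for the constraints express how Φ and R act on homogeneous
vectors, and the regular module, which has non-zero vectors in every degree, detects β. -/

theorem proj_φ (M : RepDouble β) (g x : G) (v : M.V) :
    M.ρ (elt β (x * g * x⁻¹) 1) (M.φ x v) = M.φ x (M.ρ (elt β g 1) v) := by
  classical
  have e : elt β (x * g * x⁻¹) 1 * sumElt β x = sumElt β x * elt β g 1 := by
    simp [sumElt, Finset.mul_sum, Finset.sum_mul, elt_mul_elt]
  change (M.ρ _ * M.ρ _) v = (M.ρ _ * M.ρ _) v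
  rw [← map_mul, ← map_mul, e]

theorem φ_inv_φ {M : RepDouble β} {h : G} {v : M.V} (hv : M.Homog h v) (x : G) :
    M.φ x⁻¹ (M.φ x v) = (β.θ h x⁻¹ x : k) • v := by
  have := φ_φ hv x⁻¹ x
  simpa [φ_one] using this

/-- On degree g the composite φ(x⁻¹)φ(x) is the unit scalar θ_g(x⁻¹,x). A vector in the kernel
therefore has all its homogeneous components zero. There is one scalar per degree, so φ(x⁻¹) itself
need not be an inverse up to a common factor. -/
theorem φ_injective (M : RepDouble β) (x : G) : Function.Injective (M.φ x) := by
  rw [injective_iff_map_eq_zero]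
  intro v hv
  rw [← M.sum_proj v]
  refine Finset.sum_eq_zero fun g _ => ?_
  have h1 := φ_inv_φ (M.homog_proj g v) x
  rw [← proj_φ, hv, map_zero, map_zero] at h1
  exact (smul_eq_zero.1 h1.symm).resolve_left (Units.ne_zero _)

theorem φ_bijective (M : RepDouble β) (x : G) : Function.Bijective (M.φ x) :=
  ⟨M.φ_injective x, LinearMap.injective_iff_surjective.1 (M.φ_injective x)⟩

theorem homog_of_φ {M : RepDouble β} {g x : G} {v : M.V} (h : M.Homog (x * g * x⁻¹) (M.φ x v)) :
    M.Homog g v :=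
  M.φ_injective x (by rw [← proj_φ]; exact h)

/-- The homogeneous part of degree `g`. -/
noncomputable def degSub (M : RepDouble β) (g : G) : Submodule k M.V :=
  LinearMap.eqLocus (M.ρ (elt β g 1)) LinearMap.id

theorem mem_degSub {M : RepDouble β} {g : G} {v : M.V} : v ∈ M.degSub g ↔ M.Homog g v := Iff.rfl

/-- The homogeneous part of degree `g` as a twisted representation of the centralizer of `g`. -/
noncomputable def deg (M : RepDouble β) (g : G) :
    TwistedRep (Subgroup.centralizer {g}) (β.θ g) where
  V := M.degSub g
  ρ z := (M.φ z).restrict (p := M.degSub g) (q := M.degSub g) fun v hv => by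
    have h := homog_φ (mem_degSub.1 hv) (z : G)
    have e : (z : G) * g * (z : G)⁻¹ = g := by
      have := Subgroup.mem_centralizer_singleton_iff.1 z.2
      rw [this, mul_inv_cancel_right]
    rwa [e] at h
  isUnit_ρ := TwistedRep.isUnit_of_one (α := β.θ g) _
    (by ext v; exact M.φ_one _)
    (by
      intro z w
      ext v
      have e : (z * w : G) * g * (z * w : G)⁻¹ = g := by
        have := Subgroup.mem_centralizer_singleton_iff.1 (z * w).2
        rw [Subgroup.coe_mul] at this
        rw [this, mul_inv_cancel_right]
      have := φ_φ v.2 (z : G) w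
      rw [e] at this
      exact this)
  ρ_mul z w := by
      ext v
      have e : (z * w : G) * g * (z * w : G)⁻¹ = g := by
        have := Subgroup.mem_centralizer_singleton_iff.1 (z * w).2
        rw [Subgroup.coe_mul] at this
        rw [this, mul_inv_cancel_right]
      have := φ_φ v.2 (z : G) w
      rw [e] at this
      exact this

/-- The inclusion of the homogeneous part of degree `g`. -/
noncomputable def degIncl (M : RepDouble β) (g : G) : (M.deg g).V →ₗ[k] M.V :=
  (M.degSub g).subtype

theorem degIncl_injective (M : RepDouble β) (g : G) : Function.Injective (M.degIncl g) :=
  Subtype.val_injective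

theorem homog_degIncl (M : RepDouble β) {g : G} (v : (M.deg g).V) : M.Homog g (M.degIncl g v) :=
  Subtype.property (p := (· ∈ M.degSub g)) v

theorem homog_elt (M : RepDouble β) (g x : G) (v : M.V) : M.Homog g (M.ρ (elt β g x) v) := by
  change (M.ρ _ * M.ρ _) v = _
  rw [← map_mul, elt_mul_elt]
  simp

/-- The action of `g ⌊ x`, as a map to the homogeneous part of degree `g`. -/
noncomputable def degElt (M : RepDouble β) (g x : G) : M.V →ₗ[k] (M.deg g).V :=
  (M.ρ (elt β g x)).codRestrict (M.degSub g) fun v => M.homog_elt g x v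

/-- In the product of ∑ m⌊h with g⌊x only the term m = hgh⁻¹ = g survives. For h in Z(g) this is the
equivariance of the function x ↦ (g⌊x)v, on which `toTotal` rests. -/
theorem φ_elt {M : RepDouble β} {g h : G} (hh : h * g * h⁻¹ = g) (x : G) (v : M.V) :
    M.φ h (M.ρ (elt β g x) v) = (β.θ g h x : k) • M.ρ (elt β g (h * x)) v := by
  classical
  have e : sumElt β h * elt β g x = (β.θ g h x : k) • elt β g (h * x) := by
    simp [sumElt, Finset.sum_mul, elt_mul_elt, hh]
  change (M.ρ _ * M.ρ _) v = _
  rw [← map_mul, e, map_smul]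
  rfl

noncomputable def degMap {M N : RepDouble β} (f : M ⟶ N) (g : G) : M.deg g ⟶ N.deg g where
  lin := f.lin.restrict (p := M.degSub g) (q := N.degSub g) fun _ hv => Homog.map f hv
  comm z _ := Subtype.ext (hom_φ f z _)

/-- The bundle on the inertia stack formed by the homogeneous parts of a module. -/
noncomputable def toBundle (β : NormalizedCocycle G k) : RepDouble β ⥤ InertiaBundle β where
  obj M c := M.deg (classRep c)
  map f c := degMap f (classRep c)

/-- A sequence of modules is exact if it is so in the degrees that represent the conjugacy
classes. -/
theorem shortExactLin_of_toBundle {A B C : RepDouble β} (f : A ⟶ B) (g : B ⟶ C)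
    (h : ∀ c, ShortExactLin ((toBundle β).map f c).lin ((toBundle β).map g c).lin) :
    ShortExactLin f.lin g.lin := by
  have hi : ∀ m (v : A.V), A.Homog m v → f.lin v = 0 → v = 0 := by
    intro m v hv h0
    obtain ⟨x, hx⟩ := exists_conjugator m
    -- Degree m is moved to the degree of the representative along φ(x), which commutes with every
    -- homomorphism. The same transport serves for surjectivity and for exactness in the middle.
    obtain ⟨w, rfl⟩ := (A.φ_bijective x).2 v
    rw [hx] at hv
    rw [hom_φ] at h0
    have hw := homog_of_φ hv
    have h1 := B.φ_injective x (h0.trans (map_zero _).symm)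
    have h2 := (h (ConjClasses.mk m)).1 (a₁ := (⟨w, hw⟩ : A.degSub _)) (a₂ := (0 : A.degSub _))
      (Subtype.ext (h1.trans (map_zero f.lin).symm))
    exact (congrArg (A.φ x) (congrArg Subtype.val h2)).trans (map_zero _)
  have hs : ∀ m (w : C.V), C.Homog m w → ∃ v, g.lin v = w := by
    intro m w hw
    obtain ⟨x, hx⟩ := exists_conjugator m
    obtain ⟨w, rfl⟩ := (C.φ_bijective x).2 w
    rw [hx] at hw
    obtain ⟨v, hv⟩ := (h (ConjClasses.mk m)).2.2 (⟨w, homog_of_φ hw⟩ : C.degSub _)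
    exact ⟨B.φ x (v : B.degSub _).1, by rw [hom_φ]; exact congrArg _ (congrArg Subtype.val hv)⟩
  have he : ∀ m (v : B.V), B.Homog m v → (g.lin v = 0 ↔ ∃ u, f.lin u = v) := by
    intro m v hv
    obtain ⟨x, hx⟩ := exists_conjugator m
    obtain ⟨v, rfl⟩ := (B.φ_bijective x).2 v
    rw [hx] at hv
    have hv := homog_of_φ hv
    have h1 := (h (ConjClasses.mk m)).2.1 (⟨v, hv⟩ : B.degSub _)
    constructor
    · intro h0
      rw [hom_φ] at h0
      obtain ⟨u, hu⟩ := h1.1 (Subtype.ext (C.φ_injective x (h0.trans (map_zero _).symm)))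
      exact ⟨A.φ x (u : A.degSub _).1, by rw [hom_φ]; exact congrArg _ (congrArg Subtype.val hu)⟩
    · rintro ⟨u, hu⟩
      -- The preimage u need not be homogeneous. Its component of the right degree has the same
      -- image, since that image is already homogeneous.
      have h3 : f.lin (A.ρ (elt β (x * classRep (ConjClasses.mk m) * x⁻¹) 1) u) = B.φ x v := by
        rw [f.comm, hu]; exact homog_φ hv x
      obtain ⟨u', hu'⟩ := (A.φ_bijective x).2
        (A.ρ (elt β (x * classRep (ConjClasses.mk m) * x⁻¹) 1) u)
      rw [← hu', hom_φ] at h3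
      have h4 : A.Homog (classRep (ConjClasses.mk m)) u' :=
        homog_of_φ (x := x) (by rw [hu']; exact A.homog_proj _ _)
      have h2 := h1.2 ⟨(⟨u', h4⟩ : A.degSub _), Subtype.ext (B.φ_injective x h3)⟩
      have h5 : g.lin v = 0 := congrArg Subtype.val h2
      rw [hom_φ, h5, map_zero]
  refine ⟨?_, ?_, ?_⟩
  · rw [injective_iff_map_eq_zero]
    intro v hv
    rw [← A.sum_proj v]
    exact Finset.sum_eq_zero fun m _ => hi m _ (A.homog_proj m v) (by rw [f.comm, hv, map_zero])
  · intro v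
    constructor
    · intro hv
      choose u hu using fun m => (he m _ (B.homog_proj m v)).1 (by rw [g.comm, hv, map_zero])
      exact ⟨∑ m, u m, by rw [map_sum, ← B.sum_proj v]; exact Finset.sum_congr rfl fun m _ => hu m⟩
    · rintro ⟨u, rfl⟩
      rw [← A.sum_proj u, map_sum, map_sum]
      exact Finset.sum_eq_zero fun m _ =>
        (he m _ ((A.homog_proj m u).map f)).2 ⟨_, rfl⟩
  · intro w
    choose v hv using fun m => hs m _ (C.homog_proj m w)
    exact ⟨∑ m, v m, by rw [map_sum, ← C.sum_proj w]; exact Finset.sum_congr rfl fun m _ => hv m⟩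

end RepDouble
end HomogeneousParts

/-! ### The module induced from a bundle -/

section ModuleOfBundle
variable {G k : Type u} [Group G] [Field k] {β : NormalizedCocycle G k}

/-- The functions `f : G → A` with `ρ(h) f(x) = θ_g(h,x) f(hx)` for `h ∈ Z(g)`. -/
def TwistedRep.equivariant {g : G} (A : TwistedRep (Subgroup.centralizer {g}) (β.θ g)) :
    Submodule k (G → A.V) where
  carrier := {f | ∀ (h : Subgroup.centralizer {g}) (x : G),
    A.ρ h (f x) = (β.θ g h x : k) • f (h * x)}
  add_mem' hf hg h x := by simp [hf h x, hg h x]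
  zero_mem' h x := by simp
  smul_mem' c f hf h x := by simp [hf h x, smul_comm c]

open TwistedDouble

/-- The degree x⁻¹gx depends only on the coset Z(g)x. Cutting an equivariant function down to one
degree thus leaves it equivariant. -/
theorem conj_mul_of_mem {g h : G} (hh : h ∈ Subgroup.centralizer {g}) (x : G) :
    (h * x)⁻¹ * g * (h * x) = x⁻¹ * g * x := by
  calc (h * x)⁻¹ * g * (h * x) = x⁻¹ * (h⁻¹ * g * h) * x := by simp [mul_assoc]
    _ = _ := by rw [NormalizedCocycle.conj_of_mem hh]

namespace InertiaBundle
open TwistedRep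

/-- The underlying space of the module of a bundle. -/
abbrev Total (F : InertiaBundle β) : Type u := ∀ c, (F c).equivariant

open Classical in
/-- The action of `m ⌊ y` on the module of a bundle:
`f ↦ (x ↦ θ_g(x,y) f(xy))` where `x⁻¹gx = m`, and `0` elsewhere. -/
noncomputable def totalAct (F : InertiaBundle β) (m y : G) : F.Total →ₗ[k] F.Total where
  toFun f c := ⟨fun x => if x⁻¹ * classRep c * x = m then
      (β.θ (classRep c) x y : k) • (f c).1 (x * y) else 0, fun h x => by
    have e := conj_mul_of_mem h.2 x
    simp only [e]
    split_ifs with hm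
    · have := congrArg Units.val (β.θ_cocycle (classRep c) h x y)
      rw [NormalizedCocycle.conj_of_mem h.2] at this
      simp only [Units.val_mul] at this
      rw [map_smul, (f c).2 h (x * y), smul_smul, smul_smul, mul_assoc, this, mul_comm]
    · simp⟩
  map_add' f f' := by
    ext c x
    change (if _ then _ • ((f c).1 (x * y) + (f' c).1 (x * y)) else _) = (if _ then _ else _) +
      (if _ then _ else _)
    split_ifs <;> simp
  map_smul' a f := by
    ext c x
    change (if _ then _ • (a • (f c).1 (x * y)) else _) = a • (if _ then _ else _)
    split_ifs
    · rw [smul_comm]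
    · simp

open Classical in
theorem totalAct_apply (F : InertiaBundle β) (m y : G) (f : F.Total) (c : ConjClasses G) (x : G) :
    (F.totalAct m y f c).1 x = if x⁻¹ * classRep c * x = m then
      (β.θ (classRep c) x y : k) • (f c).1 (x * y) else 0 := rfl

-- At x the composite is supported where x⁻¹gx = m and (xy)⁻¹g(xy) = n, which is possible only if m
-- = yny⁻¹. The scalars θ_g(x,y) θ_g(xy,z) then regroup as θ_g(x,yz) θ_m(y,z) by the cocycle
-- identity for θ.
open Classical in
theorem totalAct_mul (F : InertiaBundle β) (m y n z : G) :
    F.totalAct m y * F.totalAct n z =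
      if m = y * n * y⁻¹ then (β.θ m y z : k) • F.totalAct m (y * z) else 0 := by
  refine LinearMap.ext fun f => funext fun c => Subtype.ext (funext fun x => ?_)
  rw [Module.End.mul_apply, totalAct_apply, totalAct_apply]
  have e : (x * y)⁻¹ * classRep c * (x * y) = n ↔ x⁻¹ * classRep c * x = y * n * y⁻¹ := by
    rw [eq_mul_inv_iff_mul_eq, ← inv_mul_eq_iff_eq_mul]
    simp only [mul_inv_rev, mul_assoc]
  rw [e]
  by_cases h : m = y * n * y⁻¹
  · rw [if_pos h]
    change _ = (β.θ m y z : k) • (F.totalAct m (y * z) f c).1 x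
    rw [totalAct_apply, ← h]
    split_ifs with hm
    · have := congrArg Units.val (β.θ_cocycle (classRep c) x y z)
      rw [hm] at this
      simp only [Units.val_mul] at this
      rw [smul_smul, smul_smul, this, mul_assoc, mul_comm (β.θ m y z : k)]
    · simp
  · rw [if_neg h]
    change _ = (0 : (F c).V)
    split_ifs with h1 h2
    · exact absurd (h1.symm.trans h2) h
    · simp
    · rfl

variable [Fintype G]

/-- For each x exactly one m = x⁻¹gx contributes. The sum is therefore twisted right translation
without a support condition; it is the operator φ(y) of the induced module. -/
theorem sum_totalAct (F : InertiaBundle β) (y : G) (f : F.Total) (c : ConjClasses G) (x : G) :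
    ((∑ m, F.totalAct m y) f c).1 x = (β.θ (classRep c) x y : k) • (f c).1 (x * y) := by
  classical
  rw [LinearMap.sum_apply, Finset.sum_apply]
  rw [AddSubmonoidClass.coe_finsetSum, Finset.sum_apply]
  simp only [totalAct_apply]
  simp

/-- The module of a bundle. -/
noncomputable def toModule (F : InertiaBundle β) : RepDouble β where
  V := F.Total
  ρ := AlgHom.ofLinearMap ((basis β).constr k fun p => F.totalAct p.1 p.2)
    (by
      refine LinearMap.ext fun f => funext fun c => Subtype.ext (funext fun x => ?_)
      have := F.sum_totalAct 1 f c x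
      simp only [one_def, map_sum, elt, Module.Basis.constr_basis]
      rw [this]
      simp)
    (by
      classical
      intro a b
      induction a using induction with
      | zero => simp
      | add a a' h h' => simp only [add_mul, map_add, h, h']
      | smul r g x =>
        induction b using induction with
        | zero => simp
        | add a a' h h' => simp only [mul_add, map_add, h, h']
        | smul r' h y =>
          simp only [smul_mul_assoc, mul_smul_comm, map_smul, elt_mul_elt]
          simp only [elt, Module.Basis.constr_basis, totalAct_mul]
          split_ifs <;> simp)

theorem toModule_elt (F : InertiaBundle β) (m y : G) :
    F.toModule.ρ (elt β m y) = F.totalAct m y := by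
  change (basis β).constr k (fun p => F.totalAct p.1 p.2) (basis β (m, y)) = _
  rw [Module.Basis.constr_basis]

theorem toModule_φ (F : InertiaBundle β) (y : G) (f : F.Total) (c : ConjClasses G) (x : G) :
    ((show F.Total from F.toModule.φ y f) c).1 x =
      (β.θ (classRep c) x y : k) • (f c).1 (x * y) := by
  rw [← F.sum_totalAct, RepDouble.φ, sumElt, map_sum]
  simp only [toModule_elt]
  rfl

/-- When m represents a class c, the support condition confines such a function to the component c,
and there to the centralizer of m. This is what makes evaluation at 1 injective in that degree. -/
theorem toModule_homog_iff (F : InertiaBundle β) (m : G) (f : F.Total) :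
    F.toModule.Homog m f ↔ ∀ c x, x⁻¹ * classRep c * x ≠ m → (f c).1 x = 0 := by
  classical
  have e : F.toModule.Homog m f ↔ F.totalAct m 1 f = f :=
    Iff.of_eq (congrArg (fun t : F.Total →ₗ[k] F.Total => t f = f) (F.toModule_elt m 1))
  rw [e]
  constructor
  · intro h c x hx
    have := congrArg (fun f : F.Total => (f c).1 x) h
    simp only [totalAct_apply, if_neg hx] at this
    exact this.symm
  · intro h
    refine funext fun c => Subtype.ext (funext fun x => ?_)
    rw [totalAct_apply]
    split_ifs with hx
    · simp
    · exact (h c x hx).symm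

/-- The homomorphism of modules that a morphism of bundles induces. -/
noncomputable def toModuleMap {F F' : InertiaBundle β} (a : F ⟶ F') : F.toModule ⟶ F'.toModule :=
  RepDouble.mkHom (A := F.toModule) (B := F'.toModule)
    (LinearMap.pi fun c => ((a c).lin.compLeft G).restrict (p := (F c).equivariant)
        (q := (F' c).equivariant) (fun f hf h x => by
          change (F' c).ρ h ((a c).lin (f x)) = _ • (a c).lin (f (h * x))
          rw [← (a c).comm, hf h x, map_smul]) ∘ₗ LinearMap.proj c)
    (by
      classical
      intro m y f
      rw [toModule_elt, toModule_elt]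
      refine funext fun c => Subtype.ext (funext fun x => ?_)
      change (a c).lin (if _ then _ • _ else _) = if _ then _ • (a c).lin _ else _
      split_ifs
      · rw [map_smul]; rfl
      · simp)

/-- The module of a bundle on the inertia stack, as a functor. -/
noncomputable def toDouble (β : NormalizedCocycle G k) : InertiaBundle β ⥤ RepDouble β where
  obj F := F.toModule
  map a := toModuleMap a

theorem toDouble_map_smul {F F' : InertiaBundle β} (a : k) (f f' : F ⟶ F')
    (h : ∀ c, (f' c).lin = a • (f c).lin) :
    ((toDouble β).map f').lin = a • ((toDouble β).map f).lin := by
  refine LinearMap.ext fun v => funext fun c => Subtype.ext (funext fun x => ?_)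
  exact LinearMap.congr_fun (h c) _

end InertiaBundle
end ModuleOfBundle

/-! ### Bundles and modules are equivalent categories -/

section EquivalenceOfCategories
variable {G k : Type u} [Group G] [Field k]

/-- Isomorphisms become short exact sequences with zero left term, so statements about exactness
specialize to bijectivity and to the invariance of classes in the Grothendieck groups. -/
theorem ShortExactLin.bijective {U V W : Type u} [AddCommGroup U] [AddCommGroup V] [AddCommGroup W]
    [Module k U] [Module k V] [Module k W] [Subsingleton U] {f : U →ₗ[k] V} {g : V →ₗ[k] W} :
    ShortExactLin f g ↔ Function.Bijective g := by
  constructor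
  · intro h
    refine ⟨(injective_iff_map_eq_zero g).2 fun v hv => ?_, h.2.2⟩
    obtain ⟨u, rfl⟩ := (h.2.1 v).1 hv
    rw [Subsingleton.elim u 0, map_zero]
  · intro h
    refine ⟨Function.injective_of_subsingleton _, fun v => ⟨fun hv => ⟨0, ?_⟩, ?_⟩, h.2⟩
    · rw [map_zero]; exact (h.1 (hv.trans (map_zero g).symm)).symm
    · rintro ⟨u, rfl⟩
      rw [Subsingleton.elim u 0, map_zero, map_zero]

/-- A bijective intertwiner is an isomorphism. -/
noncomputable def TwistedRep.isoOfBijective {H : Subgroup G} {α : G → G → kˣ}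
    {A B : TwistedRep H α} (f : A ⟶ B) (h : Function.Bijective f.lin) : A ≅ B where
  hom := f
  inv := ⟨(LinearEquiv.ofBijective f.lin h).symm, fun x v => by
    obtain ⟨w, rfl⟩ := h.2 v
    rw [← f.comm]
    have e (w) : (LinearEquiv.ofBijective f.lin h).symm (f.lin w) = w :=
      (LinearEquiv.ofBijective f.lin h).symm_apply_apply w
    exact (e _).trans (congrArg _ (e w).symm)⟩
  hom_inv_id := TwistedRep.hom_ext (LinearMap.ext (LinearEquiv.ofBijective f.lin h).symm_apply_apply)
  inv_hom_id := TwistedRep.hom_ext (LinearMap.ext (LinearEquiv.ofBijective f.lin h).apply_symm_apply)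

/-- A family of bijective intertwiners is an isomorphism of bundles. -/
noncomputable def InertiaBundle.isoOfBijective {β : NormalizedCocycle G k} {A B : InertiaBundle β}
    (f : A ⟶ B) (h : ∀ c, Function.Bijective (f c).lin) : A ≅ B :=
  Pi.isoMk fun c => TwistedRep.isoOfBijective (f c) (h c)

theorem classRep_eq_of_conj {c d : ConjClasses G} {x : G}
    (h : x⁻¹ * classRep d * x = classRep c) : d = c := by
  rw [← mk_classRep d, ← mk_classRep c, ConjClasses.mk_eq_mk_iff_isConj, isConj_iff]
  exact ⟨x⁻¹, by simpa using h⟩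

variable [Fintype G] {β : NormalizedCocycle G k}

/-- A bijective homomorphism of modules is an isomorphism. -/
noncomputable def RepDouble.isoOfBijective {A B : RepDouble β} (f : A ⟶ B)
    (h : Function.Bijective f.lin) : A ≅ B :=
  mkIso f (LinearEquiv.ofBijective f.lin h).symm.toLinearMap
    (LinearMap.ext (LinearEquiv.ofBijective f.lin h).symm_apply_apply)
    (LinearMap.ext (LinearEquiv.ofBijective f.lin h).apply_symm_apply)

/-- The zero module. -/
noncomputable def RepDouble.zero (β : NormalizedCocycle G k) : RepDouble β where
  V := PUnit
  ρ := AlgHom.ofLinearMap 0 (Subsingleton.elim _ _) fun _ _ => Subsingleton.elim _ _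

instance : Subsingleton (RepDouble.zero β).V := inferInstanceAs (Subsingleton PUnit)

instance {H : Subgroup G} {α : G → G → kˣ} :
    Subsingleton (TwistedRep.zero : TwistedRep H α).V := inferInstanceAs (Subsingleton PUnit)

namespace RepDouble

/-- This is the exactness criterion applied to 0 → A → B, with the zero module on the left. -/
theorem bijective_of_toBundle {A B : RepDouble β} (f : A ⟶ B)
    (h : ∀ c, Function.Bijective ((toBundle β).map f c).lin) : Function.Bijective f.lin := by
  let z : zero β ⟶ A := ⟨0, fun a v => by simp⟩
  refine ShortExactLin.bijective.1 (shortExactLin_of_toBundle z f fun c => ?_)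
  have : Subsingleton ((zero β).deg (classRep c)).V :=
    inferInstanceAs (Subsingleton ((zero β).degSub (classRep c)))
  exact (ShortExactLin.bijective (U := ((zero β).deg (classRep c)).V)).2 (h c)

end RepDouble

namespace InertiaBundle
open TwistedDouble RepDouble

/-- Evaluation at `1`. -/
noncomputable def evalOne (F : InertiaBundle β) (c : ConjClasses G) :
    F.toModule.deg (classRep c) ⟶ F c where
  lin := LinearMap.proj (1 : G) ∘ₗ (F c).equivariant.subtype ∘ₗ
    (LinearMap.proj c : F.Total →ₗ[k] (F c).equivariant) ∘ₗ F.toModule.degIncl (classRep c)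
  comm z f := by
    -- Both sides are f(z): the operator φ(z) brings the value at z to the point 1, and equivariance
    -- at x = 1 has scalar θ_g(z,1) = 1.
    set f' : F.Total := F.toModule.degIncl (classRep c) f with hf
    have h1 := F.toModule_φ z f' c 1
    have h2 := (f' c).2 z 1
    simp only [NormalizedCocycle.θ_one_left, NormalizedCocycle.θ_one_right, Units.val_one, one_smul,
      one_mul, mul_one] at h1 h2
    exact h1.trans h2.symm

theorem evalOne_apply (F : InertiaBundle β) (c : ConjClasses G)
    (f : (F.toModule.deg (classRep c)).V) :
    (F.evalOne c).lin f = ((F.toModule.degIncl (classRep c) f : F.Total) c).1 1 := rfl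

-- A function of degree g lives on the single coset Z(g), where equivariance determines it by its
-- value at 1. Conversely v extends to z ↦ ρ(z)v on Z(g) and to 0 elsewhere.
open Classical in
theorem evalOne_bijective (F : InertiaBundle β) (c : ConjClasses G) :
    Function.Bijective (F.evalOne c).lin := by
  constructor
  · rw [injective_iff_map_eq_zero]
    intro f hf
    rw [evalOne_apply] at hf
    have hh := (F.toModule_homog_iff (classRep c) _).1 (F.toModule.homog_degIncl f)
    apply F.toModule.degIncl_injective
    refine funext fun d => Subtype.ext (funext fun x => ?_)
    by_cases hx : x⁻¹ * classRep d * x = classRep c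
    · obtain rfl := classRep_eq_of_conj hx
      have hz : x ∈ Subgroup.centralizer {classRep d} := by
        rw [Subgroup.mem_centralizer_singleton_iff]
        have := congrArg (fun t => x * t) hx
        simpa [mul_assoc] using this.symm
      have := ((F.toModule.degIncl (classRep d) f : F.Total) d).2 ⟨x, hz⟩ 1
      rw [hf, map_zero] at this
      simp only [NormalizedCocycle.θ_one_right, Units.val_one, one_smul, mul_one] at this
      rw [map_zero]
      exact this.symm
    · exact hh d x hx
  · intro v
    have hc {x : G} : x ∈ Subgroup.centralizer {classRep c} ↔
        x⁻¹ * classRep c * x = classRep c := by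
      rw [Subgroup.mem_centralizer_singleton_iff, mul_assoc, inv_mul_eq_iff_eq_mul, eq_comm]
    -- The component d must be compared with c before a value in F_c can be used, hence the
    -- transport along d = c.
    let f : F.Total := fun d => ⟨fun x => if h : d = c ∧ x ∈ Subgroup.centralizer {classRep c} then
      h.1 ▸ (F c).ρ ⟨x, h.2⟩ v else 0, by
        rintro ⟨y, hy⟩ x
        by_cases hd : d = c
        · subst hd
          have e : y * x ∈ Subgroup.centralizer {classRep d} ↔
              x ∈ Subgroup.centralizer {classRep d} := Subgroup.mul_mem_cancel_left _ hy
          by_cases hx : x ∈ Subgroup.centralizer {classRep d}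
          · have := LinearMap.congr_fun ((F d).ρ_mul ⟨y, hy⟩ ⟨x, hx⟩) v
            simp only [e, hx, and_self, dite_true]
            exact this
          · simp [e, hx]
        · simp [hd]⟩
    have hf : F.toModule.Homog (classRep c) f := by
      rw [toModule_homog_iff]
      intro d x hx
      refine dif_neg ?_
      rintro ⟨rfl, h⟩
      exact hx (hc.1 h)
    refine ⟨(⟨f, hf⟩ : F.toModule.degSub (classRep c)), ?_⟩
    have h1 : c = c ∧ (1 : G) ∈ Subgroup.centralizer {classRep c} := ⟨rfl, one_mem _⟩
    refine (dif_pos h1).trans ?_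
    -- That ρ(1) is the identity is no axiom of a twisted representation; it follows from ρ(1)² =
    -- θ(1,1) ρ(1) = ρ(1), because ρ(1) is invertible.
    have h2 := (F c).ρ_mul 1 1
    have h3 : (F c).ρ 1 = 1 := by
      refine (F c).isUnit_ρ 1 |>.mul_left_cancel ?_
      simpa using h2
    exact LinearMap.congr_fun h3 v

noncomputable def counitIso (β : NormalizedCocycle G k) : toDouble β ⋙ toBundle β ≅ 𝟭 _ :=
  NatIso.ofComponents (fun F => isoOfBijective (fun c => F.evalOne c) F.evalOne_bijective)
    (fun _ => rfl)

end InertiaBundle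

namespace RepDouble
open TwistedDouble InertiaBundle

/-- The unit of the equivalence: `v ↦ (x ↦ φ(x) v)`, projected to the representatives of the
conjugacy classes. -/
noncomputable def toTotal (M : RepDouble β) : M ⟶ ((toBundle β).obj M).toModule :=
  mkHom (A := M) (B := ((toBundle β).obj M).toModule)
    (LinearMap.pi fun c => (LinearMap.pi fun x => M.degElt (classRep c) x).codRestrict
      ((toBundle β).obj M c).equivariant (fun v h x => M.degIncl_injective _ (φ_elt (by
        rw [Subgroup.mem_centralizer_singleton_iff.1 h.2, mul_inv_cancel_right]) x v)))
    (by
      classical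
      intro m y v
      rw [toModule_elt]
      refine funext fun c => Subtype.ext (funext fun x => M.degIncl_injective _ ?_)
      change (M.ρ _ * M.ρ _) v = M.degIncl _ (if x⁻¹ * classRep c * x = m then
        (β.θ (classRep c) x y : k) • M.degElt (classRep c) (x * y) v else 0)
      -- The Kronecker delta in the product (g⌊x)(m⌊y) is exactly the support condition in the
      -- action of m⌊y on functions.
      have e : classRep c = x * m * x⁻¹ ↔ x⁻¹ * classRep c * x = m := by
        rw [eq_mul_inv_iff_mul_eq, mul_assoc, inv_mul_eq_iff_eq_mul]
      rw [← map_mul, elt_mul_elt, e]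
      split_ifs
      · rw [map_smul]; rfl
      · simp)

/-- In degree g = `classRep c`, evaluation at 1 after this map is v ↦ (g⌊1)v = v, a triangle
identity. Since evaluation is bijective, so is the map in each representing degree, and hence
everywhere. -/
theorem toTotal_bijective (M : RepDouble β) : Function.Bijective M.toTotal.lin := by
  refine bijective_of_toBundle _ fun c => ?_
  have h := ((toBundle β).obj M).evalOne_bijective c
  refine (Function.Bijective.of_comp_iff' h _).1 ?_
  have e : (((toBundle β).obj M).evalOne c).lin ∘ ((toBundle β).map M.toTotal c).lin = id :=
    funext fun v => M.degIncl_injective _ (M.homog_degIncl v)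
  rw [e]
  exact Function.bijective_id

noncomputable def unitIso (β : NormalizedCocycle G k) : 𝟭 _ ≅ toBundle β ⋙ toDouble β :=
  NatIso.ofComponents (fun M => isoOfBijective M.toTotal M.toTotal_bijective) fun {_ N} f =>
    hom_ext (LinearMap.ext fun v => funext fun _ => Subtype.ext (funext fun _ =>
      N.degIncl_injective _ (f.comm _ v).symm))

end RepDouble

/-- Bundles on the inertia stack are equivalent to modules over the twisted double. -/
noncomputable def bundleEquivalence (β : NormalizedCocycle G k) : InertiaBundle β ≌ RepDouble β :=
  CategoryTheory.Equivalence.mk (InertiaBundle.toDouble β) (RepDouble.toBundle β)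
    -- The two isomorphisms are named for the functor from modules to bundles. The equivalence runs
    -- the other way, so they exchange roles.
    (InertiaBundle.counitIso β).symm (RepDouble.unitIso β).symm

end EquivalenceOfCategories

/-! ### Bidegrees of a tensor product and their identification with sectors -/

section PushPullOfModules
variable {G k : Type u} [Group G] [Field k] [Fintype G] {β : NormalizedCocycle G k}

namespace RepDouble
open TwistedDouble InertiaBundle

/-- The projection to the part of bidegree `(a, b)` of a tensor product. -/
noncomputable def biProj (M N : RepDouble β) (a b : G) : M.V ⊗[k] N.V →ₗ[k] M.V ⊗[k] N.V :=
  TensorProduct.map (M.ρ (elt β a 1)) (N.ρ (elt β b 1))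

theorem biProj_homog {M N : RepDouble β} {a b : G} {u : M.V} {v : N.V} (hu : M.Homog a u)
    (hv : N.Homog b v) (a' b' : G) [DecidableEq G] :
    biProj M N a' b' (u ⊗ₜ[k] v) = if a' = a ∧ b' = b then u ⊗ₜ[k] v else 0 := by
  rw [biProj, TensorProduct.map_tmul, homog_proj_eq hu, homog_proj_eq hv]
  by_cases h1 : a' = a <;> by_cases h2 : b' = b <;> simp [h1, h2]

theorem sum_biProj (M N : RepDouble β) (t : M.V ⊗[k] N.V) :
    ∑ p : G × G, biProj M N p.1 p.2 t = t := by
  classical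
  rw [← LinearMap.sum_apply]
  refine LinearMap.congr_fun (g := LinearMap.id) (lin_ext₂ fun a u b v hu hv => ?_) t
  rw [LinearMap.sum_apply]
  simp only [biProj_homog hu hv, ← Prod.mk.injEq, Prod.mk.eta]
  simp

open Classical in
theorem biProj_biProj (M N : RepDouble β) (a b a' b' : G) (t : M.V ⊗[k] N.V) :
    biProj M N a b (biProj M N a' b' t) = if a = a' ∧ b = b' then biProj M N a b t else 0 := by
  refine LinearMap.congr_fun (f := biProj M N a b ∘ₗ biProj M N a' b')
    (g := if a = a' ∧ b = b' then biProj M N a b else 0) (lin_ext₂ fun c u d v hu hv => ?_) t |>.trans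
    (by split_ifs <;> rfl)
  rw [LinearMap.comp_apply, biProj_homog hu hv]
  split_ifs with h1 h2 h2
  · rw [h2.1, h2.2, h1.1, h1.2]
  · rw [biProj_homog hu hv, if_neg (by rwa [← h1.1, ← h1.2]), LinearMap.zero_apply]
  · rw [map_zero, biProj_homog hu hv, if_neg (by rwa [h2.1, h2.2])]
  · simp

-- Degrees multiply under Δ, so a vector of degree g has components only in bidegrees with product
-- g.
open Classical in
theorem biProj_of_homog {M N : RepDouble β} {g : G} {t : M.V ⊗[k] N.V}
    (ht : (M.tensor N).Homog g t) {a b : G} (hab : a * b ≠ g) : biProj M N a b t = 0 := by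
  rw [← ht]
  refine LinearMap.congr_fun (f := biProj M N a b ∘ₗ (M.tensor N).ρ (elt β g 1))
    (g := 0) (lin_ext₂ fun c u d v hu hv => ?_) t
  rw [LinearMap.comp_apply, homog_proj_eq (hu.tensor hv), LinearMap.zero_apply]
  split_ifs with h
  · rw [biProj_homog hu hv, if_neg]
    rintro ⟨rfl, rfl⟩
    exact hab h.symm
  · rw [map_zero]

theorem homog_biProj (M N : RepDouble β) (a b : G) (t : M.V ⊗[k] N.V) :
    (M.tensor N).Homog (a * b) (biProj M N a b t) := by
  classical
  refine LinearMap.congr_fun (f := (M.tensor N).ρ (elt β (a * b) 1) ∘ₗ biProj M N a b)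
    (g := biProj M N a b) (lin_ext₂ fun c u d v hu hv => ?_) t
  rw [LinearMap.comp_apply, biProj_homog hu hv]
  split_ifs with h
  · rw [homog_proj_eq (hu.tensor hv), h.1, h.2, if_pos rfl]
  · rw [map_zero]

/-- The operators φ(x) on a tensor product permute the bidegrees by simultaneous conjugation. This
is the permutation whose orbits and stabilizers form the push-pull product. -/
theorem biProj_φ (M N : RepDouble β) (a b x : G) (t : M.V ⊗[k] N.V) :
    biProj M N (x * a * x⁻¹) (x * b * x⁻¹) ((M.tensor N).φ x t) =
      (M.tensor N).φ x (biProj M N a b t) := by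
  classical
  refine LinearMap.congr_fun (f := biProj M N (x * a * x⁻¹) (x * b * x⁻¹) ∘ₗ (M.tensor N).φ x)
    (g := (M.tensor N).φ x ∘ₗ biProj M N a b) (lin_ext₂ fun c u d v hu hv => ?_) t
  rw [LinearMap.comp_apply, LinearMap.comp_apply, biProj_homog hu hv, tensor_φ hu hv, map_smul,
    biProj_homog (homog_φ hu x) (homog_φ hv x)]
  have e (a c : G) : x * a * x⁻¹ = x * c * x⁻¹ ↔ a = c := by simp
  rw [e, e]
  split_ifs
  · rw [tensor_φ hu hv]
  · simp

theorem biProj_φ_of_eq (M N : RepDouble β) {a b a' b' x : G} (ha : x * a * x⁻¹ = a')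
    (hb : x * b * x⁻¹ = b') (t : M.V ⊗[k] N.V) :
    biProj M N a' b' ((M.tensor N).φ x t) = (M.tensor N).φ x (biProj M N a b t) := by
  rw [← ha, ← hb, biProj_φ]

/-- The isomorphism of the restriction of the bundle of `M` to the sector of `m` with the
homogeneous part of degree `m`, as a map to `M`. -/
noncomputable def atIncl (M : RepDouble β) (m : G) :
    (((toBundle β).obj M).atElt m).V →ₗ[k] M.V :=
  M.φ (conjugator m) ∘ₗ M.degIncl (classRep (ConjClasses.mk m))

theorem homog_atIncl (M : RepDouble β) {m : G} (v : (((toBundle β).obj M).atElt m).V) :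
    M.Homog m (M.atIncl m v) := by
  have := homog_φ (M.homog_degIncl v) (conjugator m)
  rwa [← conjugator_spec] at this

theorem atIncl_injective (M : RepDouble β) (m : G) : Function.Injective (M.atIncl m) :=
  (M.φ_injective _).comp (M.degIncl_injective _)

/-- With x the conjugator, φ(z)φ(x) = θ_m(z,x) φ(zx) and φ(x)φ(x⁻¹zx) = θ_m(x,x⁻¹zx) φ(zx) on the
part of the representative. The quotient of the two scalars is the factor in `TwistedRep.conj`. -/
theorem atIncl_ρ (M : RepDouble β) {m : G} (z : Subgroup.centralizer {m})
    (v : (((toBundle β).obj M).atElt m).V) :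
    M.atIncl m ((((toBundle β).obj M).atElt m).ρ z v) = M.φ z (M.atIncl m v) := by
  have hz := Subgroup.mem_centralizer_singleton_iff.1 z.2
  have hm := conjugator_spec m
  set x := conjugator m
  have hv := M.homog_degIncl v
  have e : (z : G) * x * classRep (ConjClasses.mk m) * ((z : G) * x)⁻¹ = m := by
    calc _ = (z : G) * (x * classRep (ConjClasses.mk m) * x⁻¹) * (z : G)⁻¹ := by simp [mul_assoc]
      _ = m := by rw [← hm, hz, mul_inv_cancel_right]
  have e' : x * (x⁻¹ * z * x) = z * x := by simp [mul_assoc]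
  have h1 := φ_φ hv (z : G) x
  have h2 := φ_φ hv x (x⁻¹ * z * x)
  rw [e', e] at h2
  rw [e] at h1
  refine (M.φ x).map_smul _ _ |>.trans ?_
  refine (congrArg _ h2).trans (Eq.trans ?_ h1.symm)
  rw [smul_smul, ← Units.val_mul, div_mul_cancel]

theorem exists_atIncl {M : RepDouble β} {m : G} {v : M.V} (hv : M.Homog m v) :
    ∃ w, M.atIncl m w = v := by
  obtain ⟨w, rfl⟩ := (M.φ_bijective (conjugator m)).2 v
  have : M.Homog (classRep (ConjClasses.mk m)) w :=
    homog_of_φ (x := conjugator m) (by rwa [← conjugator_spec])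
  exact ⟨(⟨w, this⟩ : M.degSub _), rfl⟩

/-- The restriction of the bundle of `M` to the sector of `m` is the homogeneous part of
degree `m`. -/
noncomputable def atEquiv (M : RepDouble β) (m : G) :
    (((toBundle β).obj M).atElt m).V ≃ₗ[k] M.degSub m :=
  LinearEquiv.ofBijective ((M.atIncl m).codRestrict (M.degSub m) fun v => M.homog_atIncl v)
    ⟨fun _ _ h => M.atIncl_injective m (congrArg Subtype.val h), fun v => by
      obtain ⟨w, hw⟩ := exists_atIncl v.2
      exact ⟨w, Subtype.ext hw⟩⟩

/-- The projection of `M` to the restriction of its bundle to the sector of `m`. -/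
noncomputable def atProj (M : RepDouble β) (m : G) :
    M.V →ₗ[k] (((toBundle β).obj M).atElt m).V :=
  (M.atEquiv m).symm.toLinearMap ∘ₗ
    (M.ρ (elt β m 1)).codRestrict (M.degSub m) fun v => M.homog_elt m 1 v

theorem atIncl_atProj (M : RepDouble β) (m : G) (v : M.V) :
    M.atIncl m (M.atProj m v) = M.ρ (elt β m 1) v :=
  congrArg Subtype.val ((M.atEquiv m).apply_symm_apply
    ((M.ρ (elt β m 1)).codRestrict (M.degSub m) (fun v => M.homog_elt m 1 v) v))

theorem atProj_atIncl (M : RepDouble β) (m : G) (v : (((toBundle β).obj M).atElt m).V) :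
    M.atProj m (M.atIncl m v) = v :=
  M.atIncl_injective m ((M.atIncl_atProj m _).trans (M.homog_atIncl v))

theorem atEltMap_atProj {M N : RepDouble β} (f : M ⟶ N) (m : G) (v : M.V) :
    (atEltMap ((toBundle β).map f) m).lin (M.atProj m v) = N.atProj m (f.lin v) := by
  apply N.atIncl_injective
  have h : ∀ w, N.atIncl m ((atEltMap ((toBundle β).map f) m).lin w) = f.lin (M.atIncl m w) :=
    fun w => (hom_φ f _ _).symm
  rw [h, atIncl_atProj, atIncl_atProj, f.comm]

variable (M N : RepDouble β) {g : G} (s : Sector g)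

/-- With `sectorProj` this identifies the fibre over the sector s with the part of M ⊗ N of bidegree
(`s.fst`, `s.snd`): one composite is the identity, the other is `biProj`. -/
noncomputable def sectorIncl :
    (((toBundle β).obj M).sectorTensor ((toBundle β).obj N) s).V →ₗ[k] M.V ⊗[k] N.V :=
  TensorProduct.map (M.atIncl s.fst) (N.atIncl s.snd)

noncomputable def sectorProj :
    M.V ⊗[k] N.V →ₗ[k] (((toBundle β).obj M).sectorTensor ((toBundle β).obj N) s).V :=
  TensorProduct.map (M.atProj s.fst) (N.atProj s.snd)

theorem sectorProj_sectorIncl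
    (v : (((toBundle β).obj M).sectorTensor ((toBundle β).obj N) s).V) :
    sectorProj M N s (sectorIncl M N s v) = v := by
  refine LinearMap.congr_fun (f := sectorProj M N s ∘ₗ sectorIncl M N s) (g := LinearMap.id)
    (TensorProduct.ext' fun u w => ?_) v
  exact congrArg₂ (· ⊗ₜ[k] ·) (M.atProj_atIncl _ u) (N.atProj_atIncl _ w)

theorem sectorIncl_injective : Function.Injective (sectorIncl M N s) :=
  Function.LeftInverse.injective (sectorProj_sectorIncl M N s)

theorem sectorIncl_sectorProj (t : M.V ⊗[k] N.V) :
    sectorIncl M N s (sectorProj M N s t) = biProj M N s.fst s.snd t := by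
  refine LinearMap.congr_fun (f := sectorIncl M N s ∘ₗ sectorProj M N s) (g := biProj M N _ _)
    (TensorProduct.ext' fun u w => ?_) t
  change M.atIncl _ (M.atProj _ u) ⊗ₜ N.atIncl _ (N.atProj _ w) = _ ⊗ₜ _
  rw [atIncl_atProj, atIncl_atProj]

theorem biProj_sectorIncl (v : (((toBundle β).obj M).sectorTensor ((toBundle β).obj N) s).V) :
    biProj M N s.fst s.snd (sectorIncl M N s v) = sectorIncl M N s v := by
  rw [← sectorIncl_sectorProj, sectorProj_sectorIncl]

/-- An element of Z(a,b) fixes the bidegree (a,b), so the scalar that Δ gives to φ(z) there is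
γ_z(a,b), the twist in ⊗^γ. -/
theorem sectorIncl_ρ (z : Subgroup.centralizer {s.fst, s.snd})
    (v : (((toBundle β).obj M).sectorTensor ((toBundle β).obj N) s).V) :
    sectorIncl M N s ((((toBundle β).obj M).sectorTensor ((toBundle β).obj N) s).ρ z v) =
      (M.tensor N).φ z (sectorIncl M N s v) := by
  refine LinearMap.congr_fun (f := sectorIncl M N s ∘ₗ
    (((toBundle β).obj M).sectorTensor ((toBundle β).obj N) s).ρ z)
    (g := (M.tensor N).φ z ∘ₗ sectorIncl M N s) (TensorProduct.ext' fun u w => ?_) v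
  have h := tensor_φ (x := (z : G)) (M.homog_atIncl u) (N.homog_atIncl w)
  have e1 : (z : G) * s.fst * (z : G)⁻¹ = s.fst := by
    rw [← Subgroup.mem_centralizer_iff.1 z.2 s.fst (by simp), mul_inv_cancel_right]
  have e2 : (z : G) * s.snd * (z : G)⁻¹ = s.snd := by
    rw [← Subgroup.mem_centralizer_iff.1 z.2 s.snd (by simp), mul_inv_cancel_right]
  rw [e1, e2] at h
  refine Eq.trans ?_ h.symm
  refine ((sectorIncl M N s).map_smul (β.γ z s.fst s.snd : k)
    ((TwistedRep.res (centralizer_pair_le_left _ _) (((toBundle β).obj M).atElt s.fst)).ρ z u ⊗ₜ[k]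
    (TwistedRep.res (centralizer_pair_le_right _ _) (((toBundle β).obj N).atElt s.snd)).ρ z w)).trans
    (congrArg _ ?_)
  exact congrArg₂ (· ⊗ₜ[k] ·)
    (M.atIncl_ρ (Subgroup.inclusion (centralizer_pair_le_left _ _) z) u)
    (N.atIncl_ρ (Subgroup.inclusion (centralizer_pair_le_right _ _) z) w)

theorem sectorProj_φ (z : Subgroup.centralizer {s.fst, s.snd}) (t : M.V ⊗[k] N.V) :
    sectorProj M N s ((M.tensor N).φ z t) =
      (((toBundle β).obj M).sectorTensor ((toBundle β).obj N) s).ρ z (sectorProj M N s t) := by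
  apply sectorIncl_injective
  rw [sectorIncl_ρ, sectorIncl_sectorProj, sectorIncl_sectorProj]
  have e1 : (z : G) * s.fst * (z : G)⁻¹ = s.fst := by
    rw [← Subgroup.mem_centralizer_iff.1 z.2 s.fst (by simp), mul_inv_cancel_right]
  have e2 : (z : G) * s.snd * (z : G)⁻¹ = s.snd := by
    rw [← Subgroup.mem_centralizer_iff.1 z.2 s.snd (by simp), mul_inv_cancel_right]
  exact biProj_φ_of_eq M N e1 e2 t

end RepDouble
end PushPullOfModules

/-! ### The tensor product is the push-pull product -/

section TensorIsPushPull
-- An element that conjugates one pair with product g to another conjugates g to itself. The sectors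
-- over g are thus the orbits of Z(g) on pairs with product g, and each pair is moved by Z(g) to the
-- representative of its orbit.
theorem exists_sector_conj {G : Type u} [Group G] {g : G} (p : {p : G × G // p.1 * p.2 = g}) :
    ∃ x : Subgroup.centralizer {g},
      x * p.1.1 * (x : G)⁻¹ = Sector.fst (Quotient.mk (pairSetoid g) p) ∧
      x * p.1.2 * (x : G)⁻¹ = Sector.snd (Quotient.mk (pairSetoid g) p) := by
  obtain ⟨x, h1, h2⟩ := (pairSetoid g).symm (Quotient.mk_out (s := pairSetoid g) p)
  refine ⟨⟨x, ?_⟩, h1, h2⟩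
  rw [Subgroup.mem_centralizer_singleton_iff, ← mul_inv_eq_iff_eq_mul]
  conv_lhs => rw [← p.2]
  refine Eq.trans ?_ (Sector.mul (Quotient.mk (pairSetoid g) p))
  rw [Sector.fst, Sector.snd, ← h1, ← h2]
  simp [mul_assoc]

variable {G k : Type u} [Group G] [Field k] [Fintype G] {β : NormalizedCocycle G k}

namespace RepDouble
open TwistedDouble InertiaBundle
variable (M N : RepDouble β)

/-- The comparison of the tensor product of modules with the push-pull product over the class `c`,
by Frobenius reciprocity: `t ↦ (x ↦ φ(x) t)`, projected to the sectors. -/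
noncomputable def toPushPull (c : ConjClasses G) : (toBundle β).obj (M.tensor N) c ⟶
    ((toBundle β).obj M).mul ((toBundle β).obj N) c where
  lin := LinearMap.pi fun s : Sector (classRep c) =>
    (LinearMap.pi fun x : Subgroup.centralizer {classRep c} =>
      sectorProj M N s ∘ₗ (M.tensor N).φ x ∘ₗ (M.tensor N).degIncl (classRep c)).codRestrict
      (TwistedRep.indSubmodule (centralizer_pair_le_mul s.mul)
        (((toBundle β).obj M).sectorTensor ((toBundle β).obj N) s)) (fun t h x => by
        have ht := (M.tensor N).homog_degIncl t
        have h1 := φ_φ ht (h : G) x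
        have hz := (Subgroup.inclusion (centralizer_pair_le_mul s.mul) h * x).2
        rw [Subgroup.mem_centralizer_singleton_iff] at hz
        have e : (h * x : G) * classRep c * (h * x : G)⁻¹ = classRep c :=
          (congrArg (· * _) hz).trans (mul_inv_cancel_right _ _)
        rw [e] at h1
        exact (sectorProj_φ M N s h _).symm.trans
          ((congrArg (sectorProj M N s) h1).trans ((sectorProj M N s).map_smul _ _)))
  comm y t := by
    refine funext fun s => Subtype.ext (funext fun x => ?_)
    have ht := (M.tensor N).homog_degIncl t
    -- Since xy centralizes g, the composite φ(x)φ(y) has the scalar θ_g(x,y) on degree g; this is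
    -- the scalar of the induced action.
    have h1 := φ_φ ht (x : G) y
    have hz := (x * y).2
    rw [Subgroup.mem_centralizer_singleton_iff] at hz
    have e : (x * y : G) * classRep c * (x * y : G)⁻¹ = classRep c :=
      (congrArg (· * _) hz).trans (mul_inv_cancel_right _ _)
    rw [e] at h1
    exact (congrArg (sectorProj M N s) h1).trans ((sectorProj M N s).map_smul _ _)

theorem toPushPull_apply (c : ConjClasses G) (t : ((M.tensor N).deg (classRep c)).V)
    (s : Sector (classRep c)) (x : Subgroup.centralizer {classRep c}) :
    ((show ∀ s : Sector (classRep c), TwistedRep.indSubmodule (centralizer_pair_le_mul s.mul)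
      (((toBundle β).obj M).sectorTensor ((toBundle β).obj N) s) from
      (toPushPull M N c).lin t) s).1 x =
      sectorProj M N s ((M.tensor N).φ x ((M.tensor N).degIncl (classRep c) t)) := rfl

/-- Components of t whose bidegree has the wrong product vanish. Any other bidegree is moved to the
representative of its sector by some x in Z(g), and the value at x is φ(x) of that component. -/
theorem toPushPull_injective (c : ConjClasses G) : Function.Injective (toPushPull M N c).lin := by
  rw [injective_iff_map_eq_zero]
  intro t ht
  change ((M.tensor N).deg (classRep c)).V at t
  apply (M.tensor N).degIncl_injective
  refine Eq.trans ?_ (map_zero ((M.tensor N).degIncl _)).symm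
  rw [← sum_biProj M N ((M.tensor N).degIncl _ t)]
  refine Finset.sum_eq_zero fun p _ => ?_
  by_cases hp : p.1 * p.2 = classRep c
  · obtain ⟨x, h1, h2⟩ := exists_sector_conj ⟨p, hp⟩
    have h3 := congrArg (sectorIncl M N _) (toPushPull_apply M N c t (Quotient.mk _ ⟨p, hp⟩) x)
    rw [ht, sectorIncl_sectorProj, biProj_φ_of_eq M N h1 h2] at h3
    exact (M.tensor N).φ_injective x (h3.symm.trans ((map_zero (sectorIncl M N _)).trans
      (map_zero ((M.tensor N).φ x)).symm))
  · exact biProj_of_homog ((M.tensor N).homog_degIncl t) hp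

/-- The preimage is assembled one bidegree at a time: for each pair p one value of f prescribes the
component u_p of bidegree p. Equivariance under the stabilizer of the representative gives agreement
at all other points. -/
theorem toPushPull_surjective (c : ConjClasses G) :
    Function.Surjective (toPushPull M N c).lin := by
  classical
  intro f
  change ∀ s : Sector (classRep c), TwistedRep.indSubmodule (centralizer_pair_le_mul s.mul)
      (((toBundle β).obj M).sectorTensor ((toBundle β).obj N) s) at f
  choose x hx1 hx2 using exists_sector_conj (g := classRep c)
  -- The element x_p moves p to its representative, so u_p is forced by φ(x_p) u_p = f(x_p).
  choose u hu using fun p => ((M.tensor N).φ_bijective (x p : G)).2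
    (sectorIncl M N (Quotient.mk _ p) ((f (Quotient.mk _ p)).1 (x p)))
  have hb p := biProj_φ_of_eq M N (hx1 p) (hx2 p)
  have hup p : biProj M N p.1.1 p.1.2 (u p) = u p := by
    apply (M.tensor N).φ_injective (x p : G)
    rw [← hb, hu, biProj_sectorIncl]
  have hhom p : (M.tensor N).Homog (classRep c) (u p) := by
    have := homog_biProj M N p.1.1 p.1.2 (u p)
    rwa [hup, p.2] at this
  let t : ((M.tensor N).deg (classRep c)).V :=
    (∑ p, ⟨u p, hhom p⟩ : (M.tensor N).degSub (classRep c))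
  have ht : (M.tensor N).degIncl (classRep c) t = ∑ p, u p := by
    refine (AddSubmonoidClass.coe_finsetSum _ _).trans rfl
  have key p : sectorProj M N (Quotient.mk _ p) ((M.tensor N).φ (x p)
      ((M.tensor N).degIncl (classRep c) t)) = (f (Quotient.mk _ p)).1 (x p) := by
    apply sectorIncl_injective
    rw [sectorIncl_sectorProj, hb, ht, map_sum, Finset.sum_eq_single p, hup, hu]
    · intro q _ hq
      rw [← hup q, biProj_biProj, if_neg]
      rintro ⟨h1, h2⟩
      exact hq (Subtype.ext (Prod.ext h1.symm h2.symm))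
    · simp
  -- If y also moves p to the representative, then x_p y⁻¹ stabilizes the representative.
  -- Equivariance relates the values at y and at x_p on both sides, and the action of x_p y⁻¹ is
  -- invertible.
  have key' (s : Sector (classRep c)) (p) (hp : Quotient.mk _ p = s)
      (y : Subgroup.centralizer {classRep c}) (h1 : y * p.1.1 * (y : G)⁻¹ = s.fst)
      (h2 : y * p.1.2 * (y : G)⁻¹ = s.snd) :
      sectorProj M N s ((M.tensor N).φ y ((M.tensor N).degIncl (classRep c) t)) = (f s).1 y := by
    subst hp
    let h : Subgroup.centralizer {Sector.fst (Quotient.mk (pairSetoid (classRep c)) p),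
        Sector.snd (Quotient.mk (pairSetoid (classRep c)) p)} := ⟨x p * (y : G)⁻¹, by
      rw [Subgroup.mem_centralizer_iff]
      have e (m n : G) (hm : (y : G) * m * (y : G)⁻¹ = n) (hm' : x p * m * (x p : G)⁻¹ = n) :
          n * (x p * (y : G)⁻¹) = x p * (y : G)⁻¹ * n := by
        conv_lhs => rw [← hm']
        conv_rhs => rw [← hm]
        simp [mul_assoc]
      rintro m (rfl | rfl)
      · exact e _ _ h1 (hx1 p)
      · exact e _ _ h2 (hx2 p)⟩
    have hy : Subgroup.inclusion (centralizer_pair_le_mul (Sector.mul _)) h * y = x p :=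
      Subtype.ext (inv_mul_cancel_right _ _)
    apply ((Module.End.isUnit_iff _).1 ((((toBundle β).obj M).sectorTensor
      ((toBundle β).obj N) (Quotient.mk _ p)).isUnit_ρ h)).1
    have e1 := (f (Quotient.mk _ p)).2 h y
    have e2 := ((show ∀ s : Sector (classRep c), TwistedRep.indSubmodule
      (centralizer_pair_le_mul s.mul) (((toBundle β).obj M).sectorTensor ((toBundle β).obj N) s) from
      (toPushPull M N c).lin t) (Quotient.mk _ p)).2 h y
    rw [hy] at e1 e2
    exact e2.trans ((congrArg _ (key p)).trans e1.symm)
  refine ⟨t, funext fun s => Subtype.ext (funext fun y => ?_)⟩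
  -- Every y in Z(g) occurs for some pair, namely the representative of s conjugated by y⁻¹.
  have hp : ((y : G)⁻¹ * s.fst * y) * ((y : G)⁻¹ * s.snd * y) = classRep c := by
    refine Eq.trans ?_ ((congrArg (fun m : G => (y : G)⁻¹ * m * y) s.mul).trans
      (NormalizedCocycle.conj_of_mem y.2))
    simp [mul_assoc]
  have e (m : G) : (y : G) * ((y : G)⁻¹ * m * y) * (y : G)⁻¹ = m := by simp [mul_assoc]
  exact key' s ⟨(_, _), hp⟩ ((Quotient.sound (s := pairSetoid _) ⟨(y : G), e _, e _⟩).trans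
    (Quotient.out_eq s)) y (e _) (e _)

/-- The bundle of a tensor product of modules is the push-pull product of the bundles. -/
noncomputable def tensorPushPullIso (β : NormalizedCocycle G k) :
    MonoidalCategory.tensor (RepDouble β) ⋙ toBundle β ≅
      (toBundle β).prod (toBundle β) ⋙ pushPull β :=
  NatIso.ofComponents (fun P => InertiaBundle.isoOfBijective (fun c => toPushPull P.1 P.2 c)
    fun c => ⟨toPushPull_injective P.1 P.2 c, toPushPull_surjective P.1 P.2 c⟩) fun {P Q} f => by
      refine funext fun c => TwistedRep.hom_ext (LinearMap.ext fun t => funext fun s =>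
        Subtype.ext (funext fun x => ?_))
      change sectorProj Q.1 Q.2 s ((Q.1.tensor Q.2).φ x ((tensorHom f.1 f.2).lin
        ((P.1.tensor P.2).degIncl (classRep c) t))) = TensorProduct.map _ _
          (sectorProj P.1 P.2 s ((P.1.tensor P.2).φ x ((P.1.tensor P.2).degIncl (classRep c) t)))
      rw [← hom_φ]
      refine LinearMap.congr_fun (f := sectorProj Q.1 Q.2 s ∘ₗ TensorProduct.map f.1.lin f.2.lin)
        (g := (sectorTensorMap ((toBundle β).map f.1) ((toBundle β).map f.2) s).lin ∘ₗ
          sectorProj P.1 P.2 s) (TensorProduct.ext' fun u v => ?_) _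
      exact congrArg₂ (· ⊗ₜ[k] ·) (atEltMap_atProj f.1 _ u).symm (atEltMap_atProj f.2 _ v).symm

/-- The bundle of the unit module is the trivial line bundle on the untwisted sector. -/
theorem nonempty_unit_iso (β : NormalizedCocycle G k) :
    Nonempty ((toBundle β).obj (RepDouble.unit β) ≅ InertiaBundle.one β) := by
  classical
  have h (c : ConjClasses G) :
      Nonempty ((toBundle β).obj (RepDouble.unit β) c ≅ InertiaBundle.one β c) := by
    unfold InertiaBundle.one
    by_cases hc : classRep c = 1
    · rw [dif_pos hc]
      exact ⟨TwistedRep.isoOfBijective ⟨(RepDouble.unit β).degIncl (classRep c),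
        fun z v => unit_φ _ _⟩ ⟨degIncl_injective _ _, fun v => by
          have := homog_unit (β := β) v
          rw [← hc] at this
          exact ⟨(⟨v, this⟩ : (RepDouble.unit β).degSub _), rfl⟩⟩⟩
    · rw [dif_neg hc]
      refine ⟨TwistedRep.isoOfBijective ⟨0, fun z v => rfl⟩
        ⟨fun v w _ => degIncl_injective _ _ ?_, fun v => ⟨0, Subsingleton.elim _ _⟩⟩⟩
      -- The unit module is concentrated in degree 1, because ε kills g⌊1 for g ≠ 1.
      have h0 (v : ((RepDouble.unit β).deg (classRep c)).V) :
          (RepDouble.unit β).degIncl (classRep c) v = 0 := by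
        have h1 := (RepDouble.unit β).homog_degIncl v
        rw [Homog, homog_proj_eq (homog_unit _), if_neg hc] at h1
        exact h1.symm
      exact (h0 v).trans (h0 w).symm
  exact ⟨Pi.isoMk fun c => (h c).some⟩

end RepDouble
end TensorIsPushPull

/-! ### Exactness of both functors and the isomorphism of Grothendieck rings -/

section GrothendieckRings
variable {G k : Type u} [Group G] [Field k]

theorem ShortExactLin.of_ladder {U V W U' V' W' : Type u} [AddCommGroup U] [AddCommGroup V]
    [AddCommGroup W] [AddCommGroup U'] [AddCommGroup V'] [AddCommGroup W'] [Module k U] [Module k V]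
    [Module k W] [Module k U'] [Module k V'] [Module k W'] {f : U →ₗ[k] V} {g : V →ₗ[k] W}
    {f' : U' →ₗ[k] V'} {g' : V' →ₗ[k] W'} {a : U' →ₗ[k] U} {b : V' →ₗ[k] V} {c : W' →ₗ[k] W}
    (ha : Function.Bijective a) (hb : Function.Bijective b) (hc : Function.Bijective c)
    (h1 : ∀ u, f (a u) = b (f' u)) (h2 : ∀ v, g (b v) = c (g' v)) (h : ShortExactLin f g) :
    ShortExactLin f' g' := by
  refine ⟨fun u v e => ha.1 (h.1 ?_), fun v => ⟨fun hv => ?_, ?_⟩, fun w => ?_⟩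
  · rw [h1, h1, e]
  · obtain ⟨u, hu⟩ := (h.2.1 (b v)).1 (by rw [h2, hv, map_zero])
    obtain ⟨u, rfl⟩ := ha.2 u
    exact ⟨u, hb.1 ((h1 u).symm.trans hu)⟩
  · rintro ⟨u, rfl⟩
    apply hc.1
    rw [← h2, ← h1, map_zero]
    exact (h.2.1 _).2 ⟨_, rfl⟩
  · obtain ⟨v, hv⟩ := h.2.2 (c w)
    obtain ⟨v, rfl⟩ := hb.2 v
    exact ⟨v, hc.1 ((h2 v).symm.trans hv)⟩

/-- The generators are objects, not isomorphism classes. With z the zero object, 0 → z → z → z → 0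
gives [z] = 0, and an isomorphism A → B read as 0 → z → A → B → 0 gives [A] = [B]. -/
theorem GrothendieckGroup.mk_eq_of_exact {X : Type (u + 1)} {r : X → X → X → Prop} {z A B : X}
    (hz : r z z z) (h : r z A B) : mk r A = mk r B := by
  have h1 : mk r z = 0 := by simpa using mk_eq hz
  rw [mk_eq h, h1, zero_add]

theorem InertiaBundle.iso_lin_bijective {β : NormalizedCocycle G k} {A B : InertiaBundle β}
    (e : A ≅ B) (c : ConjClasses G) : Function.Bijective (e.hom c).lin := by
  rw [Function.bijective_iff_has_inverse]
  refine ⟨(e.inv c).lin, fun v => ?_, fun v => ?_⟩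
  · have := congrArg TwistedRep.Hom.lin (congrFun e.hom_inv_id c)
    exact LinearMap.congr_fun this v
  · have := congrArg TwistedRep.Hom.lin (congrFun e.inv_hom_id c)
    exact LinearMap.congr_fun this v

theorem KFull.mk_eq_of_iso [Finite G] {β : NormalizedCocycle G k} {A B : InertiaBundle β}
    (e : A ≅ B) : KFull.mk A = KFull.mk B := by
  have h {A B : InertiaBundle β} (f : A ⟶ B) (hf : ∀ c, Function.Bijective (f c).lin) :
      InertiaBundle.ShortExact (fun _ => TwistedRep.zero) A B := by
    refine ⟨fun c => ⟨0, fun x v => (map_zero _).symm⟩, f, fun c => ?_⟩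
    exact (ShortExactLin.bijective (U := (TwistedRep.zero : TwistedRep
      (Subgroup.centralizer {classRep c}) (β.θ (classRep c))).V)).2 (hf c)
  exact GrothendieckGroup.mk_eq_of_exact (h (𝟙 _) fun _ => Function.bijective_id)
    (h e.hom (InertiaBundle.iso_lin_bijective e))

variable [Fintype G]

theorem RepRing.mk_eq_of_iso {β : NormalizedCocycle G k} {A B : RepDouble β} (e : A ≅ B) :
    RepRing.mk A = RepRing.mk B := by
  have h {A B : RepDouble β} (f : A ⟶ B) (hf : Function.Bijective f.lin) :
      RepDouble.ShortExact (RepDouble.zero β) A B :=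
    ⟨⟨0, fun a v => (map_zero _).symm⟩, f, ShortExactLin.bijective.2 hf⟩
  refine GrothendieckGroup.mk_eq_of_exact (h (𝟙 _) Function.bijective_id) (h e.hom ?_)
  rw [Function.bijective_iff_has_inverse]
  exact ⟨e.inv.lin, LinearMap.congr_fun (congrArg RepDouble.Hom.lin e.hom_inv_id),
    LinearMap.congr_fun (congrArg RepDouble.Hom.lin e.inv_hom_id)⟩

open InertiaBundle RepDouble

/-- Exactness is tested in the representing degrees, where evaluation at 1 turns the induced
sequence back into the given one. -/
theorem InertiaBundle.ShortExact.toDouble {β : NormalizedCocycle G k} {A B C : InertiaBundle β}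
    (h : InertiaBundle.ShortExact A B C) : RepDouble.ShortExact ((toDouble β).obj A)
      ((toDouble β).obj B) ((toDouble β).obj C) := by
  obtain ⟨f, g, h⟩ := h
  exact ⟨(InertiaBundle.toDouble β).map f, (InertiaBundle.toDouble β).map g,
    shortExactLin_of_toBundle _ _ fun c => ShortExactLin.of_ladder (A.evalOne_bijective c)
      (B.evalOne_bijective c) (C.evalOne_bijective c) (fun _ => rfl) (fun _ => rfl) (h c)⟩

/-- The projector g⌊1 commutes with homomorphisms, so a preimage of a homogeneous vector can be
projected to a homogeneous one. -/
theorem RepDouble.ShortExact.toBundle {β : NormalizedCocycle G k} {A B C : RepDouble β}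
    (h : RepDouble.ShortExact A B C) : InertiaBundle.ShortExact ((toBundle β).obj A)
      ((toBundle β).obj B) ((toBundle β).obj C) := by
  obtain ⟨f, g, h⟩ := h
  refine ⟨(RepDouble.toBundle β).map f, (RepDouble.toBundle β).map g, fun c =>
    ⟨fun u v e => A.degIncl_injective _ (h.1 (congrArg (B.degIncl _) e)), fun v => ⟨fun hv => ?_, ?_⟩,
      fun w => ?_⟩⟩
  · obtain ⟨u, hu⟩ := (h.2.1 (B.degIncl _ v)).1 (congrArg (C.degIncl _) hv)
    refine ⟨A.degElt _ 1 u, B.degIncl_injective _ ?_⟩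
    refine (f.comm _ _).trans ?_
    rw [hu]
    exact B.homog_degIncl v
  · rintro ⟨u, rfl⟩
    exact C.degIncl_injective _ ((h.2.1 _).2 ⟨_, rfl⟩)
  · obtain ⟨v, hv⟩ := h.2.2 (C.degIncl _ w)
    refine ⟨B.degElt _ 1 v, C.degIncl_injective _ ?_⟩
    refine (g.comm _ _).trans ?_
    rw [hv]
    exact C.homog_degIncl w

/-- The module of a push-pull product is the tensor product of the modules. -/
noncomputable def toModuleMulIso {β : NormalizedCocycle G k} (F F' : InertiaBundle β) :
    (toDouble β).obj (F.mul F') ≅ (toDouble β).obj F ⊗ (toDouble β).obj F' :=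
  -- The comparison is available for bundles of modules; F and F' are first replaced by the bundles
  -- of their induced modules.
  (toDouble β).mapIso ((pushPull β).mapIso (Iso.prod ((counitIso β).app F).symm
    ((counitIso β).app F').symm) ≪≫ ((tensorPushPullIso β).app (_, _)).symm) ≪≫
    ((RepDouble.unitIso β).app _).symm

/-- The map from the twisted full K-theory to the representation ring of the twisted double. -/
noncomputable def kFullHom (β : NormalizedCocycle G k) : KFull β →+ RepRing β :=
  GrothendieckGroup.lift (fun F => RepRing.mk ((toDouble β).obj F))
    fun _ _ _ h => GrothendieckGroup.mk_eq h.toDouble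

theorem kFullHom_mk {β : NormalizedCocycle G k} (F : InertiaBundle β) :
    kFullHom β (KFull.mk F) = RepRing.mk ((toDouble β).obj F) :=
  GrothendieckGroup.lift_mk _ _ _

theorem kFullHom_mul {β : NormalizedCocycle G k} (a b : KFull β) :
    kFullHom β (a * b) = kFullHom β a * kFullHom β b := by
  -- Both sides are biadditive, so it suffices to compare them on classes of bundles.
  have h : AddMonoidHom.mul.compr₂ (kFullHom β) =
      (AddMonoidHom.mul.comp (kFullHom β)).compl₂ (kFullHom β) :=
    GrothendieckGroup.hom_ext fun F => GrothendieckGroup.hom_ext fun F' => by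
      change kFullHom β (KFull.mk F * KFull.mk F') =
        kFullHom β (KFull.mk F) * kFullHom β (KFull.mk F')
      rw [KFull.mk_mul, kFullHom_mk, kFullHom_mk, kFullHom_mk, RepRing.mk_mul,
        RepRing.mk_eq_of_iso (toModuleMulIso F F')]
  exact DFunLike.congr_fun (DFunLike.congr_fun h a) b

/-- The twisted full K-theory is the representation ring of the twisted double. -/
noncomputable def kFullEquiv (β : NormalizedCocycle G k) : KFull β ≃+* RepRing β :=
  let Ψ' : RepRing β →+ KFull β := GrothendieckGroup.lift
    (fun M => KFull.mk ((toBundle β).obj M)) fun _ _ _ h => GrothendieckGroup.mk_eq h.toBundle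
  have hΨ' M : Ψ' (RepRing.mk M) = KFull.mk ((toBundle β).obj M) := GrothendieckGroup.lift_mk _ _ _
  have h1 : Ψ'.comp (kFullHom β) = AddMonoidHom.id _ := GrothendieckGroup.hom_ext fun F =>
    (congrArg Ψ' (kFullHom_mk F)).trans
      ((hΨ' _).trans (KFull.mk_eq_of_iso ((counitIso β).app F)))
  have h2 : (kFullHom β).comp Ψ' = AddMonoidHom.id _ := GrothendieckGroup.hom_ext fun M =>
    (congrArg (kFullHom β) (hΨ' M)).trans ((kFullHom_mk _).trans
      (RepRing.mk_eq_of_iso ((RepDouble.unitIso β).app M).symm))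
  { (kFullHom β).toAddEquiv Ψ' h1 h2 with map_mul' := kFullHom_mul }

theorem kFullEquiv_mk {β : NormalizedCocycle G k} (F : InertiaBundle β) :
    kFullEquiv β (KFull.mk F) = RepRing.mk ((toDouble β).obj F) :=
  kFullHom_mk F

theorem kFullEquiv_one (β : NormalizedCocycle G k) : kFullEquiv β 1 = 1 :=
  (kFullEquiv_mk _).trans (RepRing.mk_eq_of_iso
    ((toDouble β).mapIso (nonempty_unit_iso β).some.symm ≪≫ ((RepDouble.unitIso β).app _).symm))

end GrothendieckRings

/-! ### The regular module detects the cocycle -/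

section RegularModule
variable {G k : Type u} [Group G] [Fintype G] [Field k]
open TwistedDouble

/-- The regular module of the twisted double. -/
noncomputable def RepDouble.regular (β : NormalizedCocycle G k) : RepDouble β where
  V := TwistedDouble β
  finiteDimensional := Module.Finite.of_basis (basis β)
  ρ := Algebra.lmul k (TwistedDouble β)

theorem RepDouble.homog_regular (β : NormalizedCocycle G k) (g : G) :
    (RepDouble.regular β).Homog g (elt β g 1) := by
  classical
  exact (elt_mul_elt β g 1 g 1).trans (by simp)

/-- In the regular module g⌊1 has degree g, and the triple tensor of such elements is a basis
vector, in particular non-zero. The scalar β(g,h,l)⁻¹ of the constraint must then be 1. -/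
theorem RepDouble.assocLin_eq_iff (β : NormalizedCocycle G k) :
    (∀ (U V W : RepDouble β) (u : U.V) (v : V.V) (w : W.V),
      assocLin U V W ((u ⊗ₜ[k] v) ⊗ₜ[k] w) = u ⊗ₜ[k] (v ⊗ₜ[k] w)) ↔
      ∀ g h l, β.toFun g h l = 1 := by
  constructor
  · intro H g h l
    have h1 := H (regular β) (regular β) (regular β) (elt β g 1) (elt β h 1) (elt β l 1)
    rw [assocLin_homog (homog_regular β g) (homog_regular β h) (homog_regular β l)] at h1
    have h2 := ((basis β).tensorProduct ((basis β).tensorProduct (basis β))).ne_zero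
      ((g, 1), (h, 1), (l, 1))
    rw [Module.Basis.tensorProduct_apply, Module.Basis.tensorProduct_apply] at h2
    have h3 := smul_left_injective k h2 (h1.trans (one_smul k _).symm)
    exact inv_eq_one.1 (Units.val_eq_one.1 h3)
  · intro H U V W u v w
    refine LinearMap.congr_fun (f := assocLin U V W)
      (g := (TensorProduct.assoc k U.V V.V W.V).toLinearMap) ?_ _
    refine lin_ext₃ fun g u h v l w hu hv hw => ?_
    rw [assocLin_homog hu hv hw, H]
    simp

end RegularModule

/-! ### Transport of the braided structure to bundles -/

open CategoryTheory.Monoidal in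
theorem mainTheorem2 {G k : Type u} [Group G] [Fintype G] [Field k] (β : NormalizedCocycle G k) :
    (∃ (_ : MonoidalCategory (InertiaBundle β)) (_ : BraidedCategory (InertiaBundle β))
      (E : InertiaBundle β ≌ RepDouble β) (_ : E.functor.Braided),
      Nonempty (MonoidalCategory.tensor (InertiaBundle β) ≅ InertiaBundle.pushPull β) ∧
      Nonempty (𝟙_ (InertiaBundle β) ≅ InertiaBundle.one β) ∧
      (∀ (F F' : InertiaBundle β) (a : k) (f f' : F ⟶ F'), (∀ c, (f' c).lin = a • (f c).lin) →
        (E.functor.map f').lin = a • (E.functor.map f).lin) ∧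
      ∃ Ψ : KFull β ≃+* RepRing β,
        Ψ 1 = 1 ∧ ∀ F, Ψ (KFull.mk F) = RepRing.mk (E.functor.obj F)) ∧
    (∀ (U V W : RepDouble β) (g h l : G) (u : U.V) (v : V.V) (w : W.V),
      U.Homog g u → V.Homog h v → W.Homog l w →
      (α_ U V W).hom.lin ((u ⊗ₜ[k] v) ⊗ₜ[k] w) =
        ((β.toFun g h l)⁻¹ : kˣ).val • (u ⊗ₜ[k] (v ⊗ₜ[k] w))) ∧
    (∀ (U V : RepDouble β) (g : G) (u : U.V) (v : V.V), U.Homog g u →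
      (β_ U V).hom.lin (u ⊗ₜ[k] v) = V.φ g v ⊗ₜ[k] u) ∧
    ((∀ (U V W : RepDouble β) (u : U.V) (v : V.V) (w : W.V),
      (α_ U V W).hom.lin ((u ⊗ₜ[k] v) ⊗ₜ[k] w) = u ⊗ₜ[k] (v ⊗ₜ[k] w)) ↔
      ∀ g h l, β.toFun g h l = 1) := by
  refine ⟨?_, fun U V W g h l u v w hu hv hw => RepDouble.assocLin_homog hu hv hw,
    fun U V g u v hu => RepDouble.braidLin_homog hu v, RepDouble.assocLin_eq_iff β⟩
  let e := (bundleEquivalence β).symm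
  -- Transport makes the inverse of e braided by construction, and this inverse is the functor of
  -- `bundleEquivalence`.
  refine ⟨Transported.instMonoidalCategory e, Transported.instBraidedCategory e,
    bundleEquivalence β, (inferInstance : (equivalenceTransported e).inverse.Braided), ?_, ?_, ?_,
    kFullEquiv β, kFullEquiv_one β, kFullEquiv_mk⟩
  -- The transported product of F and F' is the bundle of the tensor product of their modules. The
  -- comparison turns it into the push-pull product of the bundles of these modules, and evaluation
  -- at 1 returns to F and F'.
  · exact ⟨Functor.isoWhiskerLeft ((InertiaBundle.toDouble β).prod (InertiaBundle.toDouble β))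
      (RepDouble.tensorPushPullIso β) ≪≫ Functor.isoWhiskerRight
        (NatIso.prod (InertiaBundle.counitIso β) (InertiaBundle.counitIso β))
        (InertiaBundle.pushPull β)⟩
  · exact RepDouble.nonempty_unit_iso β
  · exact fun F F' a f f' h => InertiaBundle.toDouble_map_smul a f f' h
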